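/- Let $\alpha\in\mathbb R$. For a unitary $U$ on $\mathbb C^n$ with eigendecomposition $U=\sum_j e^{i\theta_j}|v_j\rangle\langle v_j|$, $\theta_j\in[\alpha,\alpha+2\pi)$, and $0<t<1$, put $U^t=\sum_j e^{it\theta_j}|v_j\rangle\langle v_j|$. Say that $U$ has phase gap $\delta>0$ if all $\theta_j$ lie in $[\alpha+\delta,\alpha+2\pi-\delta]$, i.e. if every eigenvalue has arc distance at least $\delta$ from the branch point $e^{i\alpha}$. In a circuit, arbitrary one- and two-qubit gates on ancilla qubits take unit time, and each use of $U$ or $U^{-1}$ controlled by an ancilla qubit takes time $C_U\ge 1$. 1. (Implementation.) There is an absolute constant $C$ such that for all $0<t<1$, $\alpha\in\mathbb R$ and $0<\varepsilon\le 1$ there is a circuit, depending on neither $U$ nor $n$ nor $C_U$, with running time at most $C\,C_U/\varepsilon$, which implements $U^t$ to precision $\varepsilon/\delta$ for every $n$ and every unitary $U$ on $\mathbb C^n$ with phase gap $\delta>0$: for every state $|d\rangle$ the circuit maps $|d\rangle|0\rangle$ to a state within distance $\varepsilon/\delta$ of $(U^t|d\rangle)|0\rangle$. In particular, for every fixed $U$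 that does not have the eigenvalue $e^{i\alpha}$, $U^t$ is implemented to precision $O(\varepsilon)$ in time $O(C_U/\varepsilon)$. 2. (Optimality.) Consider algorithms on $\mathbb C^n$, $n\ge2$, together with a finite-dimensional workspace with a fixed initial state $|w\rangle$, which alternate arbitrary free unitaries with uses of $U$ or $U^{-1}$ that may be controlled by the workspace. Say that such an algorithm implements $U^t$ to precision $\eta$ if for some workspace state $|g\rangle$ (which may depend on $U$) it maps $|d\rangle|w\rangle$ to within distance $\eta$ of $(U^t|d\rangle)|g\rangle$ for every state $|d\rangle$. For every $0<t<1$ there are $\kappa,\varepsilon_0>0$, depending only on $t$, such that for all $\alpha$, all $0<\varepsilon\le\varepsilon_0$ and all $n\ge 2$, every such algorithm that implements $U^t$ to precision $\varepsilon/\delta$ for every $\delta>0$ and every unitary $U$ with phase gap $\delta$ uses $U$ or $U^{-1}$ at least $\kappa/\varepsilon$ times. Hence the dependence on $\varepsilon$ in part 1 is optimal. 3. (Optimal phase resolution.) For every $0<t<1$ there are $\kappa,\eta,\varepsilon_0>0$, depending only on $t$, such that for all $\alpha$, all $0<\varepsilon\le\varepsilon_0$ and all $n\ge2$, every such algorithm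 that implements $U^t$ to the constant precision $\eta$ for every unitary $U$ with phase gap $\varepsilon$ uses $U$ or $U^{-1}$ at least $\kappa/\varepsilon$ times. -/

import Mathlib

open scoped Matrix Kronecker

noncomputable section

namespace QuantumPower

/-! ### Fractional powers of a unitary -/

/-- The operator with eigenbasis `v_j` (the columns of the unitary `V`) and eigenvalues
`exp (i θ_j)`, that is `∑ j, exp (i θ_j) |v_j⟩⟨v_j|`. -/
def phaseOp {n : ℕ} (V : Matrix.unitaryGroup (Fin n) ℂ) (θ : Fin n → ℝ) :
    Matrix (Fin n) (Fin n) ℂ :=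
  (V : Matrix (Fin n) (Fin n) ℂ) *
    Matrix.diagonal (fun j => Complex.exp ((θ j : ℂ) * Complex.I)) *
    (V : Matrix (Fin n) (Fin n) ℂ)ᴴ

/-- `P = U ^ t`, the eigenphases of `U` being taken in `[α, α + 2π)`:
if `U = ∑ j, exp (i θ_j) |v_j⟩⟨v_j|` then `P = ∑ j, exp (i t θ_j) |v_j⟩⟨v_j|`. -/
def IsFracPower {n : ℕ} (α t : ℝ) (U P : Matrix (Fin n) (Fin n) ℂ) : Prop :=
  ∃ (V : Matrix.unitaryGroup (Fin n) ℂ) (θ : Fin n → ℝ),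
    (∀ j, θ j ∈ Set.Ico α (α + 2 * Real.pi)) ∧
    U = phaseOp V θ ∧ P = phaseOp V (fun j => t * θ j)

/-- Every eigenphase of `U` has (arc) distance at least `δ` from the branch point `α`. -/
def HasPhaseGap {n : ℕ} (α δ : ℝ) (U : Matrix (Fin n) (Fin n) ℂ) : Prop :=
  ∀ z ∈ spectrum ℂ U, ∃ θ ∈ Set.Icc (α + δ) (α + 2 * Real.pi - δ),
    z = Complex.exp ((θ : ℂ) * Complex.I)

/-! ### States and approximate implementation -/

/-- Action of a matrix on a state vector. -/
def act {X : Type} [Fintype X] (W : Matrix X X ℂ) (ψ : EuclideanSpace ℂ X) :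
    EuclideanSpace ℂ X :=
  WithLp.toLp 2 (W *ᵥ ψ.ofLp)

/-- The product state `|d⟩|g⟩` (system first, workspace second). -/
def tensor {n : ℕ} {A : Type} (d : EuclideanSpace ℂ (Fin n)) (g : EuclideanSpace ℂ A) :
    EuclideanSpace ℂ (Fin n × A) :=
  WithLp.toLp 2 (fun p => d p.1 * g p.2)

/-- `W`, started with the workspace in state `init`, implements `P` on the system to precision `η`
and leaves the workspace in state `final`: `‖W |d⟩|init⟩ - (P |d⟩)|final⟩‖ ≤ η` for every
state `|d⟩` of the system. -/
def Implements {n : ℕ} {A : Type} [Fintype A] (W : Matrix (Fin n × A) (Fin n × A) ℂ)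
    (init final : EuclideanSpace ℂ A) (P : Matrix (Fin n) (Fin n) ℂ) (η : ℝ) : Prop :=
  ∀ d : EuclideanSpace ℂ (Fin n), ‖d‖ = 1 →
    ‖act W (tensor d init) - tensor (act P d) final‖ ≤ η

/-! ### Use of the given unitary -/

/-- What a query does to the system: nothing, apply `U`, or apply its inverse. -/
inductive Use
  | idle
  | forward
  | inverse

/-- The operator applied; for unitary `U` the inverse is the conjugate transpose. -/
def Use.op {n : ℕ} (U : Matrix (Fin n) (Fin n) ℂ) : Use → Matrix (Fin n) (Fin n) ℂ
  | .idle => 1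
  | .forward => U
  | .inverse => Uᴴ

/-- The query `∑ a, U ^ (s a) ⊗ |a⟩⟨a|`, `s a ∈ {0, 1, -1}`: the workspace controls the use of
`U`. -/
def queryGate {n : ℕ} {A : Type} [DecidableEq A] (U : Matrix (Fin n) (Fin n) ℂ) (s : A → Use) :
    Matrix (Fin n × A) (Fin n × A) ℂ :=
  Matrix.blockDiagonal (fun a => (s a).op U)

/-! ### Circuits of elementary gates and their running time -/

/-- Basis states of a register of `a` qubits. -/
abbrev Register (a : ℕ) : Type := Fin a → Fin 2

/-- The state `|0…0⟩` of the register. -/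
def zeroKet (a : ℕ) : EuclideanSpace ℂ (Register a) :=
  EuclideanSpace.single (fun _ => 0) 1

/-- One-qubit gate `G` on qubit `i` of the register. -/
def oneQubit {a : ℕ} (i : Fin a) (G : Matrix (Fin 2) (Fin 2) ℂ) :
    Matrix (Register a) (Register a) ℂ :=
  Matrix.of fun x y => if ∀ k, k ≠ i → x k = y k then G (x i) (y i) else 0

/-- Two-qubit gate `G` on the qubits `i` and `j` of the register. -/
def twoQubit {a : ℕ} (i j : Fin a) (G : Matrix (Fin 2 × Fin 2) (Fin 2 × Fin 2) ℂ) :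
    Matrix (Register a) (Register a) ℂ :=
  Matrix.of fun x y =>
    if ∀ k, k ≠ i → k ≠ j → x k = y k then G (x i, x j) (y i, y j) else 0

/-- The instructions of a circuit with `a` ancilla qubits: a one- or two-qubit gate on the ancillas,
or the application of `U` (or of its inverse) to the system, controlled by one ancilla. -/
inductive Instr (a : ℕ)
  | gate1 (i : Fin a) (G : Matrix.unitaryGroup (Fin 2) ℂ)
  | gate2 (i j : Fin a) (hij : i ≠ j) (G : Matrix.unitaryGroup (Fin 2 × Fin 2) ℂ)
  | ctrlU (i : Fin a)
  | ctrlUInv (i : Fin a)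

/-- The operator of an instruction on system and ancillas. -/
def Instr.op {a n : ℕ} (U : Matrix (Fin n) (Fin n) ℂ) :
    Instr a → Matrix (Fin n × Register a) (Fin n × Register a) ℂ
  | .gate1 i G => (1 : Matrix (Fin n) (Fin n) ℂ) ⊗ₖ oneQubit i G.1
  | .gate2 i j _ G => (1 : Matrix (Fin n) (Fin n) ℂ) ⊗ₖ twoQubit i j G.1
  | .ctrlU i => queryGate U (fun x => if x i = 1 then Use.forward else Use.idle)
  | .ctrlUInv i => queryGate U (fun x => if x i = 1 then Use.inverse else Use.idle)

/-- Running time of an instruction: elementary gates take unit time, a use of `U` takes time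
`CU`. -/
def Instr.time {a : ℕ} (CU : ℝ) : Instr a → ℝ
  | .gate1 _ _ => 1
  | .gate2 _ _ _ _ => 1
  | .ctrlU _ => CU
  | .ctrlUInv _ => CU

/-- A circuit, its first instruction being executed first. It mentions neither `U` nor the
dimension of the system. -/
abbrev Circuit (a : ℕ) : Type := List (Instr a)

/-- The operator computed by a circuit. -/
def Circuit.eval {a n : ℕ} (U : Matrix (Fin n) (Fin n) ℂ) :
    Circuit a → Matrix (Fin n × Register a) (Fin n × Register a) ℂ
  | [] => 1
  | g :: c => Circuit.eval U c * g.op U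

/-- The running time of a circuit. -/
def Circuit.time {a : ℕ} (CU : ℝ) (c : Circuit a) : ℝ :=
  (c.map (Instr.time CU)).sum

/-! ### General query algorithms -/

/-- A query algorithm on an `n`-dimensional system with workspace `A`: an initial state of the
workspace and arbitrary unitaries on system and workspace, free of charge, interleaved with
queries. -/
structure QueryAlgorithm (n : ℕ) (A : Type) [Fintype A] [DecidableEq A] where
  init : EuclideanSpace ℂ A
  norm_init : ‖init‖ = 1
  first : Matrix.unitaryGroup (Fin n × A) ℂ
  rounds : List ((A → Use) × Matrix.unitaryGroup (Fin n × A) ℂ)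

/-- The operator computed by the rounds, the head of the list coming first; in each round the query
precedes the unitary. -/
def evalRounds {n : ℕ} {A : Type} [Fintype A] [DecidableEq A] (U : Matrix (Fin n) (Fin n) ℂ) :
    List ((A → Use) × Matrix.unitaryGroup (Fin n × A) ℂ) → Matrix (Fin n × A) (Fin n × A) ℂ
  | [] => 1
  | r :: l => evalRounds U l * ((r.2 : Matrix (Fin n × A) (Fin n × A) ℂ) * queryGate U r.1)

/-- The operator computed by a query algorithm. -/
def QueryAlgorithm.eval {n : ℕ} {A : Type} [Fintype A] [DecidableEq A] (alg : QueryAlgorithm n A)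
    (U : Matrix (Fin n) (Fin n) ℂ) : Matrix (Fin n × A) (Fin n × A) ℂ :=
  evalRounds U alg.rounds * (alg.first : Matrix (Fin n × A) (Fin n × A) ℂ)

/-- The number of uses of `U` or its inverse. -/
def QueryAlgorithm.queries {n : ℕ} {A : Type} [Fintype A] [DecidableEq A]
    (alg : QueryAlgorithm n A) : ℕ :=
  alg.rounds.length

end QuantumPower

end

/-! Upper bound. On an eigenvector of `U` with eigenvalue `z = exp (iθ)`, a circuit with one ancilla
acts on that ancilla alone. Alternating rotations with `d` controlled uses of `U` produces exactly
the pairs `(P(z), Q(z))` of polynomials of degree at most `d` with `|P|² + |Q|² = 1` on the circle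
(`exists_circuit_run_eq`). It therefore suffices to find `P` close to `z^(2m) exp (itθ)` and smaller
than one on the circle. Fejér–Riesz supplies `Q` (`exists_norm_sq_eq_of_pos`,
`exists_complementary`), and `2m` uncontrolled inverses remove `z^(2m)`.

`P` averages samples of `exp (itν)` at `2m` equally spaced phases `ν`, weighted by a Jackson kernel
in `θ - ν` (`exists_kernel`, `exists_approximation`). Since the output is a unit vector, its squared
error is `2(1 - Re overlap)`, so only an average of `1 - cos (t(θ - ν))` has to be small. The gap
gives `|θ - ν| ≤ 2π - δ`, where this quantity is at most `25/δ²` times `1 - cos (θ - ν)`; the kernel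
averages the latter to `O(1/m²)`. The jump of `exp (itθ)` at the branch point is thus paid for by
the factor `1/δ²`. The norm error is `O(1/(mδ))`, and `m ≈ 15/ε` suffices.

Lower bound. Two diagonal unitaries, equal except for one phase placed at distance `ε` on either
side of the branch point, differ by at most `2ε`, so `q` queries separate their outputs by at most
`2εq` (`norm_eval_sub_le`). Their `t`-th powers differ by nearly `s = |exp (2πit) - 1| > 0` in that
entry. A second, common eigenvector compares the two final workspace states, so they cannot absorb
the difference as a phase; this forces `q ≥ s/(8ε)` (`queries_lower_bound`). It is the third claim,
and the second follows by choosing `δ` so that `ε/δ` is the constant precision. -/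

namespace QuantumPower

/-! ### Matrices acting on state vectors -/

section Act

variable {X : Type} [Fintype X]

lemma act_apply (W : Matrix X X ℂ) (ψ : EuclideanSpace ℂ X) (x : X) :
    act W ψ x = ∑ y, W x y * ψ y := rfl

lemma act_mul (W W' : Matrix X X ℂ) (ψ : EuclideanSpace ℂ X) :
    act (W * W') ψ = act W (act W' ψ) := by
  simp [act, Matrix.mulVec_mulVec]

lemma act_sub (W : Matrix X X ℂ) (ψ φ : EuclideanSpace ℂ X) :
    act W (ψ - φ) = act W ψ - act W φ := by
  simp [act, Matrix.mulVec_sub]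

lemma act_one [DecidableEq X] (ψ : EuclideanSpace ℂ X) : act (1 : Matrix X X ℂ) ψ = ψ := by
  simp [act]

lemma act_diagonal [DecidableEq X] (u : X → ℂ) (ψ : EuclideanSpace ℂ X) (x : X) :
    act (Matrix.diagonal u) ψ x = u x * ψ x := by
  simp [act, Matrix.mulVec_diagonal]

lemma norm_act_of_mem_unitaryGroup [DecidableEq X] {W : Matrix X X ℂ}
    (hW : W ∈ Matrix.unitaryGroup X ℂ) (ψ : EuclideanSpace ℂ X) : ‖act W ψ‖ = ‖ψ‖ := by
  have h : (inner ℂ (act W ψ) (act W ψ) : ℂ) = inner ℂ ψ ψ := by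
    simp only [EuclideanSpace.inner_eq_star_dotProduct, act]
    rw [Matrix.star_mulVec, dotProduct_comm, ← Matrix.dotProduct_mulVec, Matrix.mulVec_mulVec,
      ← Matrix.star_eq_conjTranspose, Matrix.mem_unitaryGroup_iff'.mp hW, Matrix.one_mulVec,
      dotProduct_comm]
  rw [inner_self_eq_norm_sq_to_K, inner_self_eq_norm_sq_to_K] at h
  have h' : ‖act W ψ‖ ^ 2 = ‖ψ‖ ^ 2 := by exact_mod_cast h
  exact (pow_left_inj₀ (norm_nonneg _) (norm_nonneg _) two_ne_zero).mp h'

lemma norm_le_of_forall_coord_le {ψ φ : EuclideanSpace ℂ X} {C : ℝ} (hC : 0 ≤ C)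
    (h : ∀ x, ‖ψ x‖ ≤ C * ‖φ x‖) : ‖ψ‖ ≤ C * ‖φ‖ := by
  refine le_of_sq_le_sq ?_ (by positivity)
  rw [mul_pow, EuclideanSpace.norm_sq_eq, EuclideanSpace.norm_sq_eq, Finset.mul_sum]
  refine Finset.sum_le_sum fun x _ => ?_
  rw [← mul_pow]
  exact pow_le_pow_left₀ (norm_nonneg _) (h x) 2

end Act

lemma norm_tensor {n : ℕ} {A : Type} [Fintype A] (d : EuclideanSpace ℂ (Fin n))
    (g : EuclideanSpace ℂ A) : ‖tensor d g‖ = ‖d‖ * ‖g‖ := by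
  refine (pow_left_inj₀ (norm_nonneg _) (by positivity) two_ne_zero).mp ?_
  rw [mul_pow, EuclideanSpace.norm_sq_eq, EuclideanSpace.norm_sq_eq, EuclideanSpace.norm_sq_eq,
    Finset.sum_mul_sum, Fintype.sum_prod_type]
  simp [tensor, mul_pow]

/-- The eigenvalue of a use of `U` on an eigenvector of `U` with eigenvalue `z`. -/
noncomputable def Use.phase (z : ℂ) : Use → ℂ
  | .idle => 1
  | .forward => z
  | .inverse => star z

lemma Use.op_diagonal {n : ℕ} (u : Fin n → ℂ) (s : Use) :
    s.op (Matrix.diagonal u) = Matrix.diagonal fun j => s.phase (u j) := by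
  cases s
  · exact Matrix.diagonal_one.symm
  · rfl
  · exact Matrix.diagonal_conjTranspose u

lemma Use.norm_phase_sub (s : Use) (z w : ℂ) : ‖s.phase z - s.phase w‖ ≤ ‖z - w‖ := by
  cases s
  · simp [Use.phase]
  · simp [Use.phase]
  · simp only [Use.phase]
    rw [← star_sub, norm_star]

lemma Use.norm_phase (s : Use) {z : ℂ} (hz : ‖z‖ = 1) : ‖s.phase z‖ = 1 := by
  cases s <;> simp [Use.phase, hz]

/-! ### Stability of query algorithms and the lower bound -/

section LowerBound

variable {n : ℕ} {A : Type} [Fintype A] [DecidableEq A]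

lemma act_queryGate_diagonal (u : Fin n → ℂ) (s : A → Use) (ψ : EuclideanSpace ℂ (Fin n × A))
    (p : Fin n × A) :
    act (queryGate (Matrix.diagonal u) s) ψ p = (s p.2).phase (u p.1) * ψ p := by
  simp only [queryGate, Use.op_diagonal]
  rw [Matrix.blockDiagonal_diagonal, act_diagonal]

lemma norm_act_queryGate_diagonal_le {u : Fin n → ℂ} (hu : ∀ j, ‖u j‖ = 1) (s : A → Use)
    (ψ : EuclideanSpace ℂ (Fin n × A)) :
    ‖act (queryGate (Matrix.diagonal u) s) ψ‖ ≤ ‖ψ‖ := by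
  simpa using norm_le_of_forall_coord_le (φ := ψ) zero_le_one fun p => by
    rw [act_queryGate_diagonal, norm_mul, Use.norm_phase _ (hu _)]

lemma norm_act_queryGate_diagonal_sub_le {u v : Fin n → ℂ} {C : ℝ} (hC : 0 ≤ C)
    (huv : ∀ j, ‖u j - v j‖ ≤ C) (s : A → Use) (ψ : EuclideanSpace ℂ (Fin n × A)) :
    ‖act (queryGate (Matrix.diagonal u) s) ψ - act (queryGate (Matrix.diagonal v) s) ψ‖
      ≤ C * ‖ψ‖ := by
  refine norm_le_of_forall_coord_le hC fun p => ?_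
  rw [PiLp.sub_apply, act_queryGate_diagonal, act_queryGate_diagonal, ← sub_mul, norm_mul]
  gcongr
  exact (Use.norm_phase_sub _ _ _).trans (huv _)

/-- The outputs of the rounds on two diagonal unitaries drift apart at most linearly in the number
of queries. -/
lemma norm_act_evalRounds_sub_le {u v : Fin n → ℂ} {C : ℝ} (hC : 0 ≤ C) (hu : ∀ j, ‖u j‖ = 1)
    (hv : ∀ j, ‖v j‖ = 1) (huv : ∀ j, ‖u j - v j‖ ≤ C)
    (l : List ((A → Use) × Matrix.unitaryGroup (Fin n × A) ℂ))
    (ψ φ : EuclideanSpace ℂ (Fin n × A)) (hψ : ‖ψ‖ ≤ 1) :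
    ‖act (evalRounds (Matrix.diagonal u) l) ψ - act (evalRounds (Matrix.diagonal v) l) φ‖
      ≤ ‖ψ - φ‖ + l.length * C := by
  induction l generalizing ψ φ with
  | nil => simp [evalRounds, act_one]
  | cons r l ih =>
    simp only [evalRounds, act_mul, List.length_cons]
    refine (ih _ _ ?_).trans ?_
    · rw [norm_act_of_mem_unitaryGroup r.2.2]
      exact (norm_act_queryGate_diagonal_le hu _ _).trans hψ
    · rw [← act_sub, norm_act_of_mem_unitaryGroup r.2.2]
      have h1 := norm_act_queryGate_diagonal_sub_le hC huv r.1 ψ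
      have h2 := norm_act_queryGate_diagonal_le hv r.1 (ψ - φ)
      rw [act_sub] at h2
      have h3 := norm_sub_le_norm_sub_add_norm_sub (act (queryGate (Matrix.diagonal u) r.1) ψ)
        (act (queryGate (Matrix.diagonal v) r.1) ψ) (act (queryGate (Matrix.diagonal v) r.1) φ)
      have h4 : C * ‖ψ‖ ≤ C := mul_le_of_le_one_right hC hψ
      push_cast
      linarith

lemma norm_eval_sub_le (alg : QueryAlgorithm n A) {u v : Fin n → ℂ} {C : ℝ} (hC : 0 ≤ C)
    (hu : ∀ j, ‖u j‖ = 1) (hv : ∀ j, ‖v j‖ = 1) (huv : ∀ j, ‖u j - v j‖ ≤ C)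
    {d : EuclideanSpace ℂ (Fin n)} (hd : ‖d‖ = 1) :
    ‖act (alg.eval (Matrix.diagonal u)) (tensor d alg.init)
      - act (alg.eval (Matrix.diagonal v)) (tensor d alg.init)‖ ≤ alg.queries * C := by
  simp only [QueryAlgorithm.eval, act_mul]
  refine (norm_act_evalRounds_sub_le hC hu hv huv _ _ _ ?_).trans ?_
  · rw [norm_act_of_mem_unitaryGroup alg.first.2, norm_tensor, hd, alg.norm_init, one_mul]
  · simp [QueryAlgorithm.queries]

/-- Final workspace states of an algorithm run on a common eigenvector of two diagonal unitaries. -/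
lemma norm_smul_final_sub_le (alg : QueryAlgorithm n A) {u v p q : Fin n → ℂ} {C η : ℝ}
    (hC : 0 ≤ C) (hu : ∀ j, ‖u j‖ = 1) (hv : ∀ j, ‖v j‖ = 1) (huv : ∀ j, ‖u j - v j‖ ≤ C)
    {g h : EuclideanSpace ℂ A}
    (hg : Implements (alg.eval (Matrix.diagonal u)) alg.init g (Matrix.diagonal p) η)
    (hh : Implements (alg.eval (Matrix.diagonal v)) alg.init h (Matrix.diagonal q) η)
    (j : Fin n) : ‖p j • g - q j • h‖ ≤ 2 * η + alg.queries * C := by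
  set d : EuclideanSpace ℂ (Fin n) := EuclideanSpace.single j 1 with hd
  have hd1 : ‖d‖ = 1 := by simp [hd]
  have key : ∀ (p : Fin n → ℂ) (g : EuclideanSpace ℂ A),
      tensor (act (Matrix.diagonal p) d) g = tensor d (p j • g) := by
    intro p g
    ext x
    simp only [tensor, act_diagonal, hd, PiLp.single_apply, PiLp.smul_apply,
      smul_eq_mul]
    split_ifs with hx
    · rw [hx]; ring
    · simp
  have e1 := hg d hd1
  have e2 := hh d hd1
  have e3 := norm_eval_sub_le alg hC hu hv huv hd1
  rw [key] at e1 e2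
  have e4 : tensor d (p j • g) - tensor d (q j • h) = tensor d (p j • g - q j • h) := by
    ext x
    simp [tensor, mul_sub]
  have e5 : ‖p j • g - q j • h‖ = ‖tensor d (p j • g) - tensor d (q j • h)‖ := by
    rw [e4, norm_tensor, hd1, one_mul]
  rw [e5]
  rw [norm_sub_rev] at e1
  have e6 := norm_sub_le_norm_sub_add_norm_sub (tensor d (p j • g))
    (act (alg.eval (Matrix.diagonal u)) (tensor d alg.init)) (tensor d (q j • h))
  have e7 := norm_sub_le_norm_sub_add_norm_sub
    (act (alg.eval (Matrix.diagonal u)) (tensor d alg.init))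
    (act (alg.eval (Matrix.diagonal v)) (tensor d alg.init)) (tensor d (q j • h))
  linarith

end LowerBound

lemma phaseOp_one {n : ℕ} (θ : Fin n → ℝ) :
    phaseOp 1 θ = Matrix.diagonal fun j => Complex.exp ((θ j : ℂ) * Complex.I) := by
  simp [phaseOp]

lemma hasPhaseGap_phaseOp_one {n : ℕ} {α δ : ℝ} {θ : Fin n → ℝ}
    (hθ : ∀ j, θ j ∈ Set.Icc (α + δ) (α + 2 * Real.pi - δ)) :
    HasPhaseGap α δ (phaseOp 1 θ) := by
  intro z hz
  rw [phaseOp_one, spectrum_diagonal] at hz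
  obtain ⟨j, rfl⟩ := hz
  exact ⟨θ j, hθ j, rfl⟩

/-- Two unitaries with phase gap `ε` which differ by `2ε` have fractional powers that differ by a
constant, beyond any choice of global phases. -/
theorem queries_lower_bound {t : ℝ} (ht : t ∈ Set.Ioo (0 : ℝ) 1) {s : ℝ}
    (hs : s = ‖Complex.exp (((t * (2 * Real.pi) : ℝ) : ℂ) * Complex.I) - 1‖) {α ε : ℝ}
    (hε : ε ∈ Set.Ioc 0 (s / 8)) {n : ℕ} (hn : 2 ≤ n) {A : Type} [Fintype A] [DecidableEq A]
    (alg : QueryAlgorithm n A)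
    (h : ∀ U P : Matrix (Fin n) (Fin n) ℂ, IsFracPower α t U P → HasPhaseGap α ε U →
      ∃ g : EuclideanSpace ℂ A, ‖g‖ = 1 ∧ Implements (alg.eval U) alg.init g P (s / 16)) :
    s / 8 / ε ≤ (alg.queries : ℝ) := by
  obtain ⟨hε0, hε1⟩ := hε
  have hs2 : s ≤ 2 := by
    rw [hs]
    refine (norm_sub_le _ _).trans ?_
    rw [Complex.norm_exp_ofReal_mul_I, norm_one]
    norm_num
  have hpi := Real.pi_gt_three
  let i0 : Fin n := ⟨0, by omega⟩
  let i1 : Fin n := ⟨1, by omega⟩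
  have hi : i1 ≠ i0 := by simp [i0, i1]
  -- The phase at `i0` will sit just inside either end of the branch interval. The phase at `i1` is
  -- a common reference that ties the two final workspace states together.
  let θ : ℝ → Fin n → ℝ := fun x j => if j = i0 then x else α + Real.pi
  have run : ∀ x ∈ Set.Icc (α + ε) (α + 2 * Real.pi - ε), ∃ g : EuclideanSpace ℂ A, ‖g‖ = 1 ∧
      Implements (alg.eval (phaseOp 1 (θ x))) alg.init g (phaseOp 1 fun j => t * θ x j)
        (s / 16) := by
    intro x hx
    have hθ : ∀ j, θ x j ∈ Set.Icc (α + ε) (α + 2 * Real.pi - ε) := by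
      intro j
      simp only [θ]
      split_ifs
      · exact hx
      · constructor <;> linarith
    refine h _ _ ⟨1, θ x, fun j => ?_, rfl, rfl⟩ (hasPhaseGap_phaseOp_one hθ)
    exact ⟨by linarith [(hθ j).1], by linarith [(hθ j).2]⟩
  obtain ⟨g, hg, hgi⟩ := run (α + ε) ⟨le_rfl, by linarith⟩
  obtain ⟨k, hk, hki⟩ := run (α + 2 * Real.pi - ε) ⟨by linarith, le_rfl⟩
  rw [phaseOp_one, phaseOp_one] at hgi hki
  have hexp : ∀ x y : ℝ, ‖Complex.exp (x * Complex.I) - Complex.exp (y * Complex.I)‖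
      ≤ |x - y| := by
    intro x y
    have e : Complex.exp (x * Complex.I) - Complex.exp (y * Complex.I)
        = Complex.exp (y * Complex.I) * (Complex.exp (Complex.I * ((x - y : ℝ) : ℂ)) - 1) := by
      rw [mul_sub, ← Complex.exp_add, mul_one]
      congr 2
      push_cast
      ring
    rw [e, norm_mul, Complex.norm_exp_ofReal_mul_I, one_mul]
    exact Real.norm_exp_I_mul_ofReal_sub_one_le
  have main := norm_smul_final_sub_le alg (C := 2 * ε) (by positivity)
    (fun j => Complex.norm_exp_ofReal_mul_I _) (fun j => Complex.norm_exp_ofReal_mul_I _)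
    (fun j => by
      by_cases hj : j = i0
      · simp only [θ, hj, if_true]
        have e : Complex.exp (((α + 2 * Real.pi - ε : ℝ) : ℂ) * Complex.I)
            = Complex.exp (((α - ε : ℝ) : ℂ) * Complex.I) := by
          rw [← Complex.exp_periodic ((((α - ε : ℝ) : ℂ) * Complex.I))]
          congr 1
          push_cast
          ring
        rw [e]
        refine (hexp _ _).trans ?_
        rw [abs_of_nonneg (by linarith)]
        linarith
      · simp only [θ, hj, if_false, sub_self, norm_zero]
        positivity)
    hgi hki
  have m0 := main i0
  have m1 := main i1
  simp only [θ, if_true, if_neg hi] at m0 m1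
  rw [← smul_sub, norm_smul, Complex.norm_exp_ofReal_mul_I, one_mul] at m1
  set a := Complex.exp (((t * (α + ε) : ℝ) : ℂ) * Complex.I) with ha
  set b := Complex.exp (((t * (α + 2 * Real.pi - ε) : ℝ) : ℂ) * Complex.I) with hb
  have ha1 : ‖a‖ = 1 := Complex.norm_exp_ofReal_mul_I _
  -- The bound at `i1` controls `g - k`, the common phase factoring out; combined with the bound at
  -- `i0` it eliminates the workspace.
  have hba : ‖b - a‖ ≤ 4 * (s / 16) + alg.queries * (4 * ε) := by
    have e : (b - a) • k = a • (g - k) - (a • g - b • k) := by module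
    have e1 : ‖b - a‖ = ‖(b - a) • k‖ := by rw [norm_smul, hk, mul_one]
    rw [e1, e]
    refine (norm_sub_le _ _).trans ?_
    rw [norm_smul, ha1]
    linarith
  -- Shifting the phase of `b` by `2tε` makes its ratio to `a` exactly `exp (2πit)`.
  have hsb : s ≤ ‖b - a‖ + 2 * ε := by
    have e : Complex.exp (((t * (2 * Real.pi) : ℝ) : ℂ) * Complex.I) - 1
        = a⁻¹ * ((Complex.exp (((t * (α + ε + 2 * Real.pi) : ℝ) : ℂ) * Complex.I) - b)
          + (b - a)) := by
      have e2 : Complex.exp (((t * (α + ε + 2 * Real.pi) : ℝ) : ℂ) * Complex.I)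
          = a * Complex.exp (((t * (2 * Real.pi) : ℝ) : ℂ) * Complex.I) := by
        rw [ha, ← Complex.exp_add]
        congr 1
        push_cast
        ring
      have ha0 : a ≠ 0 := Complex.exp_ne_zero _
      rw [e2]
      field_simp
      ring
    rw [hs, e, norm_mul, norm_inv, ha1, inv_one, one_mul]
    refine (norm_add_le _ _).trans ?_
    have := hexp (t * (α + ε + 2 * Real.pi)) (t * (α + 2 * Real.pi - ε))
    rw [← mul_sub, abs_mul, abs_of_pos ht.1,
      abs_of_nonneg (by linarith : 0 ≤ α + ε + 2 * Real.pi - (α + 2 * Real.pi - ε))] at this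
    nlinarith [ht.2]
  -- Now `s ≤ s/4 + 4qε + 2ε` with `2ε ≤ s/4`, which leaves `s/2 ≤ 4qε`.
  rw [div_le_iff₀ hε0]
  nlinarith

lemma norm_exp_mul_two_pi_sub_one_pos {t : ℝ} (ht : t ∈ Set.Ioo (0 : ℝ) 1) :
    0 < ‖Complex.exp (((t * (2 * Real.pi) : ℝ) : ℂ) * Complex.I) - 1‖ := by
  rw [norm_pos_iff, sub_ne_zero]
  intro h
  obtain ⟨k, hk⟩ := Complex.exp_eq_one_iff.mp h
  have hI : (2 * Real.pi * Complex.I : ℂ) ≠ 0 := Complex.two_pi_I_ne_zero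
  have e : (t : ℂ) = k := by
    apply mul_right_cancel₀ hI
    rw [← hk]
    push_cast
    ring
  have e' : t = k := by exact_mod_cast e
  obtain ⟨h0, h1⟩ := ht
  rw [e'] at h0 h1
  have : (0 : ℤ) < k := by exact_mod_cast h0
  have : k < (1 : ℤ) := by exact_mod_cast h1
  omega

/-! ### Reflected polynomials and the Fejér–Riesz theorem -/

open Polynomial ComplexConjugate

/-- The polynomial `z ^ d * conj (F (1 / conj z))`. -/
noncomputable def conjReflect (d : ℕ) (F : ℂ[X]) : ℂ[X] :=
  (F.map (starRingEnd ℂ)).reflect d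

lemma coeff_conjReflect (d : ℕ) (F : ℂ[X]) (i : ℕ) :
    (conjReflect d F).coeff i = conj (F.coeff (revAt d i)) := by
  rw [conjReflect, coeff_reflect, coeff_map]

lemma natDegree_conjReflect_le {d : ℕ} {F : ℂ[X]} (hF : F.natDegree ≤ d) :
    (conjReflect d F).natDegree ≤ d :=
  natDegree_reflect_le.trans (max_le le_rfl (natDegree_map_le.trans hF))

lemma eval_conjReflect {d : ℕ} {F : ℂ[X]} (hF : F.natDegree ≤ d) {z : ℂ} (hz : z ≠ 0) :
    (conjReflect d F).eval z = z ^ d * conj (F.eval (conj z)⁻¹) := by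
  let _ : Invertible z⁻¹ := invertibleOfNonzero (inv_ne_zero hz)
  have h := eval₂_reflect_mul_pow (RingHom.id ℂ) z⁻¹ d (F.map (starRingEnd ℂ))
    (natDegree_map_le.trans hF)
  rw [invOf_eq_inv, inv_inv] at h
  have h' : (F.map (starRingEnd ℂ)).eval z⁻¹ = conj (F.eval (conj z)⁻¹) := by
    rw [eval_map, ← eval₂_hom, map_inv₀, Complex.conj_conj]
  rw [← h', conjReflect, ← eval₂_id, ← eval₂_id, ← h, inv_pow, mul_left_comm,
    mul_inv_cancel₀ (pow_ne_zero d hz), mul_one]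

lemma conj_inv_eq_self {z : ℂ} (hz : ‖z‖ = 1) : (conj z)⁻¹ = z := by
  rw [inv_eq_iff_eq_inv, Complex.inv_def, Complex.normSq_eq_norm_sq, hz]
  simp

lemma ne_zero_of_norm_eq_one {z : ℂ} (hz : ‖z‖ = 1) : z ≠ 0 :=
  norm_ne_zero_iff.mp (by rw [hz]; exact one_ne_zero)

lemma mul_conj_of_norm_eq_one {z : ℂ} (hz : ‖z‖ = 1) : z * conj z = 1 := by
  rw [Complex.mul_conj, Complex.normSq_eq_norm_sq, hz]
  simp

lemma eval_conjReflect_of_norm_eq_one {d : ℕ} {F : ℂ[X]} (hF : F.natDegree ≤ d) {z : ℂ}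
    (hz : ‖z‖ = 1) : (conjReflect d F).eval z = z ^ d * conj (F.eval z) := by
  rw [eval_conjReflect hF (ne_zero_of_norm_eq_one hz), conj_inv_eq_self hz]

lemma eval_mul_conjReflect {d : ℕ} {F : ℂ[X]} (hF : F.natDegree ≤ d) {z : ℂ}
    (hz : ‖z‖ = 1) : (F * conjReflect d F).eval z = z ^ d * (‖F.eval z‖ ^ 2 : ℝ) := by
  rw [eval_mul, eval_conjReflect_of_norm_eq_one hF hz, mul_left_comm, Complex.mul_conj,
    Complex.normSq_eq_norm_sq]

/-- The circle is infinite. This turns identities between values on it into identities between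
coefficients. -/
lemma eq_of_eval_eq_on_circle {F G : ℂ[X]} (h : ∀ z : ℂ, ‖z‖ = 1 → F.eval z = G.eval z) :
    F = G := by
  refine eq_of_infinite_eval_eq F G (Set.Infinite.mono (s := Metric.sphere (0 : ℂ) 1) ?_ ?_)
  · intro z hz
    exact h z (by simpa using hz)
  · refine Set.infinite_of_injOn_mapsTo (f := fun x : ℝ => Complex.exp (x * Complex.I)) ?_ ?_
      (Set.Ioo_infinite (zero_lt_one (α := ℝ)))
    · intro x hx y hy hxy
      have hpi := Real.pi_gt_three
      have e := Complex.exp_inj_of_neg_pi_lt_of_le_pi (x := x * Complex.I) (y := y * Complex.I)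
        (by simp; linarith [hx.1]) (by simp; linarith [hx.2]) (by simp; linarith [hy.1])
        (by simp; linarith [hy.2]) hxy
      exact_mod_cast mul_right_cancel₀ Complex.I_ne_zero e
    · intro x _
      simp [Complex.norm_exp_ofReal_mul_I]

/-- A trigonometric polynomial that is positive on the circle is the square of the modulus of a
polynomial (Fejér and Riesz). -/
theorem exists_norm_sq_eq_of_pos (N : ℕ) (R : ℂ[X]) (hR : R.natDegree ≤ 2 * N)
    (h : ∀ z : ℂ, ‖z‖ = 1 → ∃ x : ℝ, 0 < x ∧ R.eval z = x * z ^ N) :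
    ∃ Q : ℂ[X], Q.natDegree ≤ N ∧
      ∀ z : ℂ, ‖z‖ = 1 → R.eval z = (‖Q.eval z‖ ^ 2 : ℝ) * z ^ N := by
  induction N generalizing R with
  | zero =>
    obtain ⟨c, rfl⟩ := natDegree_eq_zero.mp (Nat.le_zero.mp hR)
    obtain ⟨x, hx, hxc⟩ := h 1 norm_one
    refine ⟨C ((Real.sqrt x : ℝ) : ℂ), by simp, fun z _ => ?_⟩
    simp only [eval_C, pow_zero, mul_one] at hxc ⊢
    rw [hxc, Complex.norm_real, Real.norm_of_nonneg (Real.sqrt_nonneg _), Real.sq_sqrt hx.le]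
  | succ N ih =>
    have hne : ∀ z : ℂ, ‖z‖ = 1 → R.eval z ≠ 0 := by
      intro z hz
      obtain ⟨x, hx, e⟩ := h z hz
      rw [e]
      exact mul_ne_zero (by exact_mod_cast hx.ne') (pow_ne_zero _ (ne_zero_of_norm_eq_one hz))
    have hR0 : R ≠ 0 := by
      rintro rfl
      exact hne 1 norm_one (by simp)
    -- Realness of `R / z^(N+1)` on the circle is self-reciprocity of `R`, so the roots come in
    -- pairs mirrored in the circle.
    have hself : conjReflect (2 * (N + 1)) R = R := by
      refine eq_of_eval_eq_on_circle fun z hz => ?_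
      obtain ⟨x, -, e⟩ := h z hz
      rw [eval_conjReflect_of_norm_eq_one hR hz, e, map_mul, map_pow, Complex.conj_ofReal, two_mul,
        pow_add]
      have := mul_conj_of_norm_eq_one hz
      calc z ^ (N + 1) * z ^ (N + 1) * (x * conj z ^ (N + 1))
          = x * z ^ (N + 1) * (z * conj z) ^ (N + 1) := by rw [mul_pow]; ring
        _ = x * z ^ (N + 1) := by rw [this, one_pow, mul_one]
    -- A constant `R` would have to be positive at `z = 1` and negative where `z^(N+1) = -1`.
    have hroot : ∃ r, R.IsRoot r := by
      by_contra hno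
      have hdeg : ¬ 0 < R.degree := fun hd => hno (Complex.exists_root hd)
      rw [eq_C_of_degree_le_zero (not_lt.mp hdeg)] at h
      simp only [eval_C] at h
      obtain ⟨x, hx, e⟩ := h 1 norm_one
      obtain ⟨y, hy, e'⟩ := h (Complex.exp ((Real.pi / (N + 1) : ℝ) * Complex.I))
        (Complex.norm_exp_ofReal_mul_I _)
      rw [← Complex.exp_nat_mul] at e'
      have hN : ((N : ℂ) + 1) ≠ 0 := by exact_mod_cast Nat.succ_ne_zero N
      have e2 : ((N + 1 : ℕ) : ℂ) * (((Real.pi / (N + 1) : ℝ) : ℂ) * Complex.I)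
          = Real.pi * Complex.I := by
        push_cast
        field_simp
      rw [e2, Complex.exp_pi_mul_I, e] at e'
      have : x = -y := by
        simp only [one_pow, mul_one, mul_neg] at e'
        exact_mod_cast e'
      linarith
    obtain ⟨r, hr⟩ := hroot
    by_cases hr0 : r = 0
    · subst hr0
      have hc0 : R.coeff 0 = 0 := by rwa [coeff_zero_eq_eval_zero]
      -- The mirror image of a root at `0` is one at infinity: the top coefficient vanishes too, and
      -- dividing by `X` lowers the degree bound by two.
      have hdeg : R.natDegree ≤ 2 * N + 1 := by
        refine natDegree_le_iff_coeff_eq_zero.mpr fun k hk => ?_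
        rcases lt_or_ge (2 * (N + 1)) k with hk' | hk'
        · exact coeff_eq_zero_of_natDegree_lt (hR.trans_lt hk')
        · obtain rfl : k = 2 * (N + 1) := by omega
          rw [← hself, coeff_conjReflect, revAt_le le_rfl, Nat.sub_self, hc0, map_zero]
      have hX : X * R.divX = R := by
        conv_rhs => rw [← X_mul_divX_add R, hc0, C_0, add_zero]
      obtain ⟨Q, hQ, hQz⟩ := ih R.divX (by rw [natDegree_divX_eq_natDegree_tsub_one]; omega)
        fun z hz => by
          obtain ⟨x, hx, e⟩ := h z hz
          refine ⟨x, hx, mul_left_cancel₀ (ne_zero_of_norm_eq_one hz) ?_⟩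
          rw [← hX, eval_mul, eval_X] at e
          rw [e]
          ring
      refine ⟨Q, hQ.trans (Nat.le_succ N), fun z hz => ?_⟩
      rw [← hX, eval_mul, eval_X, hQz z hz]
      ring
    · have hrn : ‖r‖ ≠ 1 := fun hn => hne r hn hr
      set r' := (conj r)⁻¹ with hr'
      have hcr0 : conj r ≠ 0 := (_root_.map_ne_zero _).mpr hr0
      have hr'root : R.eval r' = 0 := by
        have h0 : conj r' ≠ 0 := by simpa [hr'] using hr0
        have := eval_conjReflect hR (z := r') (inv_ne_zero hcr0)
        rw [hself, hr', map_inv₀, Complex.conj_conj, inv_inv, hr, map_zero, mul_zero] at this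
        exact this
      have hrr' : r' ≠ r := by
        intro he
        apply hrn
        have h1 : r * conj r = 1 := by
          nth_rewrite 1 [← he]
          exact inv_mul_cancel₀ hcr0
        rw [Complex.mul_conj, Complex.normSq_eq_norm_sq] at h1
        have h2 : ‖r‖ ^ 2 = 1 := by exact_mod_cast h1
        exact (pow_eq_one_iff_of_nonneg (norm_nonneg r) two_ne_zero).mp h2
      obtain ⟨R1, hR1⟩ := dvd_iff_isRoot.mpr hr
      have hR1r : R1.IsRoot r' := by
        rw [hR1, eval_mul, eval_sub, eval_X, eval_C] at hr'root
        exact (mul_eq_zero.mp hr'root).resolve_left (sub_ne_zero.mpr hrr')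
      obtain ⟨R2, hR2⟩ := dvd_iff_isRoot.mpr hR1r
      have hRR : R = (X - C r) * ((X - C r') * R2) := by rw [hR1, hR2]
      have hR20 : R2 ≠ 0 := by
        rintro rfl
        exact hR0 (by simp [hRR])
      have hdeg : R.natDegree = R2.natDegree + 2 := by
        rw [hRR, natDegree_mul (X_sub_C_ne_zero _) (mul_ne_zero (X_sub_C_ne_zero _) hR20),
          natDegree_mul (X_sub_C_ne_zero _) hR20, natDegree_X_sub_C, natDegree_X_sub_C]
        ring
      -- On the circle the mirrored pair contributes `|z - r|²` up to a constant and one factor `z`,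
      -- so removing it preserves positivity and `X - C r` goes into `Q`.
      have hzr : ∀ z : ℂ, ‖z‖ = 1 →
          R.eval z = (‖z - r‖ ^ 2 : ℝ) * z * (C (-(conj r)⁻¹) * R2).eval z := by
        intro z hz
        have e : z - r' = -(conj r)⁻¹ * z * conj (z - r) := by
          rw [map_sub]
          have := mul_conj_of_norm_eq_one hz
          rw [hr']
          field_simp
          linear_combination this
        rw [hRR, eval_mul, eval_mul, eval_sub, eval_sub, eval_X, eval_C, eval_C, eval_mul, eval_C,
          e, ← Complex.normSq_eq_norm_sq, ← Complex.mul_conj]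
        ring
      have hzr0 : ∀ z : ℂ, ‖z‖ = 1 → z - r ≠ 0 := fun z hz h0 =>
        hrn (by rw [← sub_eq_zero.mp h0, hz])
      obtain ⟨Q, hQ, hQz⟩ := ih (C (-(conj r)⁻¹) * R2)
        ((natDegree_C_mul_le _ _).trans (by omega)) fun z hz => by
          obtain ⟨x, hx, e⟩ := h z hz
          have hp : 0 < ‖z - r‖ ^ 2 := by
            have := norm_pos_iff.mpr (hzr0 z hz)
            positivity
          refine ⟨x / ‖z - r‖ ^ 2, by positivity, ?_⟩
          have hz0 := ne_zero_of_norm_eq_one hz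
          have hp' : ((‖z - r‖ ^ 2 : ℝ) : ℂ) ≠ 0 := by exact_mod_cast hp.ne'
          apply mul_left_cancel₀ (mul_ne_zero hp' hz0)
          rw [← hzr z hz, e, Complex.ofReal_div]
          field_simp
          ring
      refine ⟨(X - C r) * Q, natDegree_mul_le.trans ?_, fun z hz => ?_⟩
      · rw [natDegree_X_sub_C]
        omega
      · rw [hzr z hz, hQz z hz, eval_mul, eval_sub, eval_X, eval_C, norm_mul, mul_pow]
        push_cast
        ring

/-- A polynomial smaller than one on the circle is the first entry of a unit vector of
polynomials. -/
theorem exists_complementary {d : ℕ} {P : ℂ[X]} (hP : P.natDegree ≤ d)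
    (h : ∀ z : ℂ, ‖z‖ = 1 → ‖P.eval z‖ < 1) :
    ∃ Q : ℂ[X], Q.natDegree ≤ d ∧
      ∀ z : ℂ, ‖z‖ = 1 → ‖P.eval z‖ ^ 2 + ‖Q.eval z‖ ^ 2 = 1 := by
  have hz : ∀ z : ℂ, ‖z‖ = 1 →
      (X ^ d - P * conjReflect d P).eval z = (1 - ‖P.eval z‖ ^ 2 : ℝ) * z ^ d := by
    intro z hz
    rw [eval_sub, eval_mul_conjReflect hP hz, eval_pow, eval_X]
    push_cast
    ring
  obtain ⟨Q, hQ, hQz⟩ := exists_norm_sq_eq_of_pos d (X ^ d - P * conjReflect d P)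
    ((natDegree_sub_le _ _).trans (max_le (by rw [natDegree_X_pow]; omega)
      (natDegree_mul_le.trans (by have := natDegree_conjReflect_le hP; omega))))
    fun z hz1 => ⟨_, by nlinarith [h z hz1, norm_nonneg (P.eval z)], hz z hz1⟩
  refine ⟨Q, hQ, fun z hz1 => ?_⟩
  have e := (hz z hz1).symm.trans (hQz z hz1)
  have e' := mul_right_cancel₀ (pow_ne_zero d (ne_zero_of_norm_eq_one hz1)) e
  have e2 : 1 - ‖P.eval z‖ ^ 2 = ‖Q.eval z‖ ^ 2 := by exact_mod_cast e'
  linarith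

/-! ### Circuits with one ancilla, acting on an eigenvector of `U` -/

/-- The effect of an instruction on the ancilla when the system is in an eigenstate with
eigenvalue `z`. -/
noncomputable def Instr.run (z : ℂ) : Instr 1 → (Fin 2 → ℂ) → Fin 2 → ℂ
  | .gate1 _ G, v => G.1 *ᵥ v
  -- A default value: one qubit has no two distinct positions.
  | .gate2 _ _ _ _, v => v
  | .ctrlU _, v => ![v 0, z * v 1]
  | .ctrlUInv _, v => ![v 0, conj z * v 1]

/-- The effect of a circuit on the ancilla when the system is in an eigenstate with
eigenvalue `z`. -/
noncomputable def Circuit.run (z : ℂ) (c : Circuit 1) (v : Fin 2 → ℂ) : Fin 2 → ℂ :=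
  c.foldl (fun v g => g.run z v) v

lemma Circuit.run_append (z : ℂ) (c c' : Circuit 1) (v : Fin 2 → ℂ) :
    Circuit.run z (c ++ c') v = Circuit.run z c' (Circuit.run z c v) :=
  List.foldl_append

lemma Circuit.time_append (CU : ℝ) (c c' : Circuit 1) :
    Circuit.time CU (c ++ c') = c.time CU + c'.time CU := by
  simp [Circuit.time]

lemma Instr.run_smul (z a : ℂ) (g : Instr 1) (v : Fin 2 → ℂ) :
    g.run z (a • v) = a • g.run z v := by
  cases g
  · exact Matrix.mulVec_smul _ _ _
  · rfl
  · ext i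
    fin_cases i <;> simp [Instr.run, mul_left_comm]
  · ext i
    fin_cases i <;> simp [Instr.run, mul_left_comm]

lemma Circuit.run_smul (z a : ℂ) (c : Circuit 1) (v : Fin 2 → ℂ) :
    Circuit.run z c (a • v) = a • Circuit.run z c v := by
  induction c generalizing v with
  | nil => rfl
  | cons g c ih =>
    change Circuit.run z c (g.run z (a • v)) = a • Circuit.run z c (g.run z v)
    rw [Instr.run_smul, ih]

/-- The state of system and ancilla in which the ancilla is in state `v j` when the system is in the
basis state `j`. -/
def branchState {n : ℕ} (v : Fin n → Fin 2 → ℂ) : EuclideanSpace ℂ (Fin n × Register 1) :=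
  WithLp.toLp 2 fun p => v p.1 (p.2 0)

/-- A diagonal `U` never mixes basis states of the system, so the ancilla evolves separately in each
branch. -/
lemma act_instr_branchState {n : ℕ} (u : Fin n → ℂ) (g : Instr 1) (v : Fin n → Fin 2 → ℂ) :
    act (g.op (Matrix.diagonal u)) (branchState v) = branchState fun j => g.run (u j) (v j) := by
  have h2 : ∀ a : Fin 2, a = 1 ∨ a = 0 := by decide
  ext ⟨j, x⟩
  cases g with
  | gate1 i G =>
    obtain rfl : i = 0 := Subsingleton.elim _ _
    rw [act_apply, Fintype.sum_prod_type, Finset.sum_eq_single j]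
    · simp only [Instr.op, Matrix.kroneckerMap_apply, Matrix.one_apply_eq, one_mul, branchState,
        Instr.run, Matrix.mulVec, dotProduct]
      refine Fintype.sum_equiv (Equiv.funUnique (Fin 1) (Fin 2)) _ _ fun y => ?_
      simp [oneQubit, Subsingleton.elim _ (0 : Fin 1)]
    · intro k _ hk
      simp [Instr.op, Matrix.one_apply_ne hk.symm]
    · simp
  | gate2 i k hik G => exact absurd (Subsingleton.elim i k) hik
  | ctrlU i =>
    obtain rfl : i = 0 := Subsingleton.elim _ _
    rw [Instr.op, act_queryGate_diagonal]
    rcases h2 (x 0) with h | h <;> simp [branchState, Instr.run, Use.phase, h]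
  | ctrlUInv i =>
    obtain rfl : i = 0 := Subsingleton.elim _ _
    rw [Instr.op, act_queryGate_diagonal]
    rcases h2 (x 0) with h | h <;> simp [branchState, Instr.run, Use.phase, h]

lemma act_eval_branchState {n : ℕ} (u : Fin n → ℂ) (c : Circuit 1) (v : Fin n → Fin 2 → ℂ) :
    act (c.eval (Matrix.diagonal u)) (branchState v)
      = branchState fun j => Circuit.run (u j) c (v j) := by
  induction c generalizing v with
  | nil => exact act_one _
  | cons g c ih => rw [Circuit.eval, act_mul, act_instr_branchState, ih]; rfl

section Conjugation

variable {n a : ℕ} (V : Matrix.unitaryGroup (Fin n) ℂ) (D : Matrix (Fin n) (Fin n) ℂ)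

lemma Use.op_conj_mul (s : Use) :
    s.op (V.1 * D * V.1ᴴ) * V.1 = V.1 * s.op D := by
  have hV : V.1ᴴ * V.1 = 1 := Matrix.mem_unitaryGroup_iff'.mp V.2
  cases s
  · simp [Use.op]
  · simp only [Use.op]
    rw [mul_assoc, hV, mul_one]
  · simp only [Use.op, Matrix.conjTranspose_mul, Matrix.conjTranspose_conjTranspose]
    rw [mul_assoc, mul_assoc, hV, mul_one]

lemma queryGate_conj_mul (s : Register a → Use) :
    queryGate (V.1 * D * V.1ᴴ) s * (V.1 ⊗ₖ (1 : Matrix (Register a) (Register a) ℂ))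
      = (V.1 ⊗ₖ (1 : Matrix (Register a) (Register a) ℂ)) * queryGate D s := by
  simp only [queryGate, Matrix.kronecker_one, ← Matrix.blockDiagonal_mul, Use.op_conj_mul]

lemma Instr.op_conj_mul (g : Instr a) :
    g.op (V.1 * D * V.1ᴴ) * (V.1 ⊗ₖ (1 : Matrix (Register a) (Register a) ℂ))
      = (V.1 ⊗ₖ (1 : Matrix (Register a) (Register a) ℂ)) * g.op D := by
  cases g
  · simp only [Instr.op, ← Matrix.mul_kronecker_mul, one_mul, mul_one]
  · simp only [Instr.op, ← Matrix.mul_kronecker_mul, one_mul, mul_one]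
  · exact queryGate_conj_mul V D _
  · exact queryGate_conj_mul V D _

/-- Gates touch only the ancillas, so a change of eigenbasis passes through the circuit; this
reduces every `U` to a diagonal one. -/
lemma Circuit.eval_conj_mul (c : Circuit a) :
    c.eval (V.1 * D * V.1ᴴ) * (V.1 ⊗ₖ (1 : Matrix (Register a) (Register a) ℂ))
      = (V.1 ⊗ₖ (1 : Matrix (Register a) (Register a) ℂ)) * c.eval D := by
  induction c with
  | nil => simp [Circuit.eval]
  | cons g c ih =>
    rw [Circuit.eval, Circuit.eval, mul_assoc, Instr.op_conj_mul, ← mul_assoc, ih, mul_assoc]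

lemma act_kronecker_one_tensor (W : Matrix (Fin n) (Fin n) ℂ) (d : EuclideanSpace ℂ (Fin n))
    (g : EuclideanSpace ℂ (Register a)) :
    act (W ⊗ₖ (1 : Matrix (Register a) (Register a) ℂ)) (tensor d g) = tensor (act W d) g := by
  ext ⟨j, x⟩
  rw [act_apply, Fintype.sum_prod_type]
  simp only [Matrix.kroneckerMap_apply, tensor, act_apply, Matrix.one_apply, mul_ite, mul_one,
    mul_zero, ite_mul, zero_mul, Finset.sum_ite_eq, Finset.mem_univ, if_true, Finset.sum_mul,
    mul_assoc]

lemma norm_act_kronecker_one (ψ : EuclideanSpace ℂ (Fin n × Register a)) :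
    ‖act (V.1 ⊗ₖ (1 : Matrix (Register a) (Register a) ℂ)) ψ‖ = ‖ψ‖ := by
  refine norm_act_of_mem_unitaryGroup (Matrix.mem_unitaryGroup_iff'.mpr ?_) ψ
  have hV : V.1ᴴ * V.1 = 1 := Matrix.mem_unitaryGroup_iff'.mp V.2
  rw [Matrix.star_eq_conjTranspose, Matrix.conjTranspose_kronecker, ← Matrix.mul_kronecker_mul, hV,
    Matrix.conjTranspose_one, one_mul, Matrix.one_kronecker_one]

end Conjugation

lemma tensor_zeroKet {n : ℕ} (d : EuclideanSpace ℂ (Fin n)) :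
    tensor d (zeroKet 1) = branchState fun j => d j • ![1, 0] := by
  ext ⟨j, x⟩
  have h2 : ∀ a : Fin 2, a = 1 ∨ a = 0 := by decide
  have hx : x = (fun _ => 0) ↔ x 0 = 0 := by
    rw [funext_iff]
    exact ⟨fun h => h 0, fun h i => by rw [Subsingleton.elim i 0, h]⟩
  rcases h2 (x 0) with h | h <;> simp [tensor, zeroKet, branchState, PiLp.single_apply, hx, h]

/-- A circuit which is accurate on every eigenvalue is accurate. -/
lemma implements_of_run {n : ℕ} (V : Matrix.unitaryGroup (Fin n) ℂ) (θ φ : Fin n → ℝ)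
    (c : Circuit 1) {η : ℝ} (hη : 0 ≤ η)
    (h : ∀ j, ‖Circuit.run (Complex.exp (θ j * Complex.I)) c ![1, 0] 0
          - Complex.exp (φ j * Complex.I)‖ ^ 2
        + ‖Circuit.run (Complex.exp (θ j * Complex.I)) c ![1, 0] 1‖ ^ 2 ≤ η ^ 2) :
    Implements (c.eval (phaseOp V θ)) (zeroKet 1) (zeroKet 1) (phaseOp V φ) η := by
  intro d hd
  have hV : V.1 * V.1ᴴ = 1 := Matrix.mem_unitaryGroup_iff.mp V.2
  set e := act V.1ᴴ d with he
  have hed : act V.1 e = d := by rw [he, ← act_mul, hV, act_one]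
  have hen : ‖e‖ = 1 := by
    rw [← hd, ← hed, norm_act_of_mem_unitaryGroup V.2]
  have h1 : act (c.eval (phaseOp V θ)) (tensor d (zeroKet 1))
      = act (V.1 ⊗ₖ (1 : Matrix (Register 1) (Register 1) ℂ)) (branchState fun j =>
          e j • Circuit.run (Complex.exp (θ j * Complex.I)) c ![1, 0]) := by
    rw [← hed, ← act_kronecker_one_tensor, ← act_mul, phaseOp, Circuit.eval_conj_mul, act_mul,
      tensor_zeroKet, act_eval_branchState]
    simp only [Circuit.run_smul]
  have h2 : tensor (act (phaseOp V φ) d) (zeroKet 1)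
      = act (V.1 ⊗ₖ (1 : Matrix (Register 1) (Register 1) ℂ)) (branchState fun j =>
          e j • ![Complex.exp (φ j * Complex.I), 0]) := by
    rw [phaseOp, act_mul, ← he, act_mul, ← act_kronecker_one_tensor, tensor_zeroKet]
    congr 2
    ext j i
    rw [act_diagonal]
    fin_cases i <;> simp [mul_comm]
  rw [h1, h2, ← act_sub, norm_act_kronecker_one]
  refine le_of_sq_le_sq ?_ hη
  rw [EuclideanSpace.norm_sq_eq, Fintype.sum_prod_type]
  have hsum : ∀ j, (∑ x : Register 1, ‖((branchState fun j =>
        e j • Circuit.run (Complex.exp (θ j * Complex.I)) c ![1, 0])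
        - branchState fun j => e j • ![Complex.exp (φ j * Complex.I), 0]) (j, x)‖ ^ 2)
      ≤ ‖e j‖ ^ 2 * η ^ 2 := by
    intro j
    rw [Fintype.sum_equiv (Equiv.funUnique (Fin 1) (Fin 2)) _ (fun i : Fin 2 =>
      ‖e j‖ ^ 2 * ‖Circuit.run (Complex.exp (θ j * Complex.I)) c ![1, 0] i
        - (![Complex.exp (φ j * Complex.I), 0] : Fin 2 → ℂ) i‖ ^ 2) fun x => by
        simp [branchState, ← mul_sub, mul_pow]]
    rw [Fin.sum_univ_two, ← mul_add]
    gcongr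
    simpa using h j
  refine (Finset.sum_le_sum fun j _ => hsum j).trans ?_
  rw [← Finset.sum_mul, ← EuclideanSpace.norm_sq_eq, hen, one_pow, one_mul]

/-! ### Polynomials computed by alternating gates and controlled uses of `U` -/

/-- The rotation with first column `(x, y)`. -/
def rotation (x y : ℂ) : Matrix (Fin 2) (Fin 2) ℂ :=
  !![x, -conj y; y, conj x]

lemma rotation_mem_unitaryGroup {x y : ℂ} (h : ‖x‖ ^ 2 + ‖y‖ ^ 2 = 1) :
    rotation x y ∈ Matrix.unitaryGroup (Fin 2) ℂ := by
  rw [Matrix.mem_unitaryGroup_iff']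
  have h' : x * conj x + y * conj y = 1 := by
    rw [Complex.mul_conj, Complex.mul_conj, Complex.normSq_eq_norm_sq, Complex.normSq_eq_norm_sq]
    exact_mod_cast h
  ext i j
  fin_cases i <;> fin_cases j <;> simp [rotation, Matrix.mul_apply, Matrix.star_apply]
  · linear_combination h'
  · ring
  · ring
  · linear_combination h'

/-- Two orthogonal vectors of `ℂ²` are parallel to the columns of a rotation. -/
lemma exists_rotation_of_orthogonal {p q p' q' : ℂ} (h : p * conj p' + q * conj q' = 0) :
    ∃ x y : ℂ, ‖x‖ ^ 2 + ‖y‖ ^ 2 = 1 ∧ x * q = y * p ∧ conj x * p' + conj y * q' = 0 := by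
  have normalize : ∀ a b : ℂ, (a ≠ 0 ∨ b ≠ 0) → ∃ r : ℝ, r ≠ 0 ∧
      ‖(r : ℂ) * a‖ ^ 2 + ‖(r : ℂ) * b‖ ^ 2 = 1 := by
    intro a b hab
    have hpos : 0 < ‖a‖ ^ 2 + ‖b‖ ^ 2 := by
      rcases hab with h | h
      · have := norm_pos_iff.mpr h
        positivity
      · have := norm_pos_iff.mpr h
        positivity
    refine ⟨(Real.sqrt (‖a‖ ^ 2 + ‖b‖ ^ 2))⁻¹, by positivity, ?_⟩
    rw [norm_mul, norm_mul, mul_pow, mul_pow, ← mul_add, Complex.norm_real, norm_inv, inv_pow,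
      Real.norm_of_nonneg (Real.sqrt_nonneg _), Real.sq_sqrt hpos.le, inv_mul_cancel₀ hpos.ne']
  by_cases hp : p ≠ 0 ∨ q ≠ 0
  · obtain ⟨r, -, hr⟩ := normalize p q hp
    refine ⟨r * p, r * q, hr, by ring, ?_⟩
    have := congrArg conj h
    simp only [map_add, map_mul, Complex.conj_conj, map_zero] at this
    rw [map_mul, map_mul, Complex.conj_ofReal]
    linear_combination (r : ℂ) * this
  · push Not at hp
    obtain ⟨rfl, rfl⟩ := hp
    by_cases hp' : -conj q' ≠ 0 ∨ conj p' ≠ 0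
    · obtain ⟨r, -, hr⟩ := normalize _ _ hp'
      refine ⟨_, _, hr, by ring, ?_⟩
      rw [map_mul, map_mul, Complex.conj_ofReal, map_neg, Complex.conj_conj, Complex.conj_conj]
      ring
    · push Not at hp'
      have e1 : q' = 0 := by simpa using hp'.1
      have e2 : p' = 0 := by simpa using hp'.2
      exact ⟨1, 0, by simp, by simp, by simp [e1, e2]⟩

lemma norm_sq_rotate (x y a b : ℂ) (h : ‖x‖ ^ 2 + ‖y‖ ^ 2 = 1) :
    ‖conj x * a + conj y * b‖ ^ 2 + ‖x * b - y * a‖ ^ 2 = ‖a‖ ^ 2 + ‖b‖ ^ 2 := by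
  have key : ((‖conj x * a + conj y * b‖ ^ 2 + ‖x * b - y * a‖ ^ 2 : ℝ) : ℂ)
      = ((‖x‖ ^ 2 + ‖y‖ ^ 2) * (‖a‖ ^ 2 + ‖b‖ ^ 2) : ℝ) := by
    simp only [← Complex.normSq_eq_norm_sq, Complex.ofReal_add, Complex.ofReal_mul,
      ← Complex.mul_conj, map_add, map_sub, map_mul, Complex.conj_conj]
    ring
  rw [h, one_mul] at key
  exact_mod_cast key

/-- Every unit vector of polynomials of degree at most `d` is computed with `d` controlled uses
of `U`. -/
theorem exists_circuit_run_eq (d : ℕ) (P Q : ℂ[X]) (hP : P.natDegree ≤ d) (hQ : Q.natDegree ≤ d)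
    (h : ∀ z : ℂ, ‖z‖ = 1 → ‖P.eval z‖ ^ 2 + ‖Q.eval z‖ ^ 2 = 1) :
    ∃ c : Circuit 1, (∀ CU : ℝ, c.time CU = d * (CU + 1) + 1) ∧
      ∀ z : ℂ, ‖z‖ = 1 → Circuit.run z c ![1, 0] = ![P.eval z, Q.eval z] := by
  induction d generalizing P Q with
  | zero =>
    obtain ⟨p, rfl⟩ := natDegree_eq_zero.mp (Nat.le_zero.mp hP)
    obtain ⟨q, rfl⟩ := natDegree_eq_zero.mp (Nat.le_zero.mp hQ)
    have h1 := h 1 norm_one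
    simp only [eval_C] at h1 ⊢
    refine ⟨[.gate1 0 ⟨_, rotation_mem_unitaryGroup h1⟩], fun CU => ?_, fun z _ => ?_⟩
    · simp [Circuit.time, Instr.time]
    · ext i
      fin_cases i <;> simp [Circuit.run, Instr.run, rotation]
  | succ d ih =>
    have hpoly : P * conjReflect (d + 1) P + Q * conjReflect (d + 1) Q = X ^ (d + 1) := by
      refine eq_of_eval_eq_on_circle fun z hz => ?_
      rw [eval_add, eval_mul_conjReflect hP hz, eval_mul_conjReflect hQ hz, ← mul_add,
        ← Complex.ofReal_add, h z hz, eval_pow, eval_X, Complex.ofReal_one, mul_one]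
    -- The constant coefficient of `hpoly`: reflection moves the conjugated top coefficient to
    -- degree zero.
    have horth : P.coeff 0 * conj (P.coeff (d + 1)) + Q.coeff 0 * conj (Q.coeff (d + 1)) = 0 := by
      have := congrArg (fun F : ℂ[X] => F.coeff 0) hpoly
      simpa [mul_coeff_zero, coeff_conjReflect, coeff_X_pow] using this
    obtain ⟨x, y, hxy, h0, hd⟩ := exists_rotation_of_orthogonal horth
    have hxy' : x * conj x + y * conj y = 1 := by
      rw [Complex.mul_conj, Complex.mul_conj, Complex.normSq_eq_norm_sq,
        Complex.normSq_eq_norm_sq]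
      exact_mod_cast hxy
    -- Undoing the last rotation kills the top coefficient of the first entry and the constant one
    -- of the second. The factor `X` of the second entry is then one controlled use of `U`.
    set P' := C (conj x) * P + C (conj y) * Q with hP'
    set Q' := C x * Q - C y * P with hQ'
    have hP'd : P'.natDegree ≤ d := by
      refine natDegree_le_iff_coeff_eq_zero.mpr fun k hk => ?_
      rw [hP', coeff_add, coeff_C_mul, coeff_C_mul]
      rcases lt_or_ge (d + 1) k with hk' | hk'
      · rw [coeff_eq_zero_of_natDegree_lt (hP.trans_lt hk'),
          coeff_eq_zero_of_natDegree_lt (hQ.trans_lt hk')]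
        simp
      · obtain rfl : k = d + 1 := by omega
        exact hd
    have hQ'X : X * Q'.divX = Q' := by
      have hc : Q'.coeff 0 = 0 := by
        rw [hQ', coeff_sub, coeff_C_mul, coeff_C_mul, h0, sub_self]
      conv_rhs => rw [← X_mul_divX_add Q', hc, C_0, add_zero]
    have hQ'd : Q'.divX.natDegree ≤ d := by
      have : Q'.natDegree ≤ d + 1 := (natDegree_sub_le _ _).trans
        (max_le ((natDegree_C_mul_le _ _).trans hQ) ((natDegree_C_mul_le _ _).trans hP))
      rw [natDegree_divX_eq_natDegree_tsub_one]
      omega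
    have hQ'z : ∀ z, z * Q'.divX.eval z = x * Q.eval z - y * P.eval z := by
      intro z
      have : z * Q'.divX.eval z = (X * Q'.divX).eval z := by rw [eval_mul, eval_X]
      rw [this, hQ'X, hQ', eval_sub, eval_mul, eval_mul, eval_C, eval_C]
    have hP'z : ∀ z, P'.eval z = conj x * P.eval z + conj y * Q.eval z := by
      intro z
      rw [hP', eval_add, eval_mul, eval_mul, eval_C, eval_C]
    obtain ⟨c, hct, hcz⟩ := ih P' Q'.divX hP'd hQ'd fun z hz => by
      have e : ‖Q'.divX.eval z‖ = ‖x * Q.eval z - y * P.eval z‖ := by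
        rw [← hQ'z, norm_mul, hz, one_mul]
      rw [hP'z, e, norm_sq_rotate _ _ _ _ hxy, h z hz]
    refine ⟨c ++ [.ctrlU 0, .gate1 0 ⟨_, rotation_mem_unitaryGroup hxy⟩], fun CU => ?_,
      fun z hz => ?_⟩
    · rw [Circuit.time_append, hct]
      simp only [Circuit.time, Instr.time, List.map_cons, List.map_nil, List.sum_cons,
        List.sum_nil]
      push_cast
      ring
    · rw [Circuit.run_append, hcz z hz]
      have e1 := hP'z z
      have e2 := hQ'z z
      ext i
      fin_cases i
      · simp [Circuit.run, Instr.run, rotation]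
        rw [e1, e2]
        linear_combination P.eval z * hxy'
      · simp [Circuit.run, Instr.run, rotation]
        rw [e1, e2]
        linear_combination Q.eval z * hxy'

/-- Multiplication by `z⁻¹`, that is the uncontrolled use of the inverse of `U`. -/
lemma exists_circuit_run_shift (N : ℕ) :
    ∃ c : Circuit 1, (∀ CU : ℝ, c.time CU = N * (2 * CU + 2)) ∧
      ∀ (z : ℂ) (v : Fin 2 → ℂ), Circuit.run z c v = conj z ^ N • v := by
  have hX : (!![0, 1; 1, 0] : Matrix (Fin 2) (Fin 2) ℂ) ∈ Matrix.unitaryGroup (Fin 2) ℂ := by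
    rw [Matrix.mem_unitaryGroup_iff']
    ext i j
    fin_cases i <;> fin_cases j <;> simp [Matrix.mul_apply, Matrix.star_apply]
  induction N with
  | zero => exact ⟨[], by simp [Circuit.time], fun z v => by simp [Circuit.run]⟩
  | succ N ih =>
    obtain ⟨c, hct, hcz⟩ := ih
    refine ⟨c ++ [.ctrlUInv 0, .gate1 0 ⟨_, hX⟩, .ctrlUInv 0, .gate1 0 ⟨_, hX⟩], fun CU => ?_,
      fun z v => ?_⟩
    · rw [Circuit.time_append, hct]
      simp only [Circuit.time, Instr.time, List.map_cons, List.map_nil, List.sum_cons,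
        List.sum_nil]
      push_cast
      ring
    · rw [Circuit.run_append, hcz]
      ext i
      fin_cases i <;> simp [Circuit.run, Instr.run] <;> ring

/-! ### A positive kernel concentrated near `1` -/

lemma sum_pow_mul_conj_pow {M : ℕ} {ω : ℂ} (hω : IsPrimitiveRoot ω M) (hω1 : ‖ω‖ = 1) {k l : ℕ}
    (hk : k < M) (hl : l < M) :
    ∑ j ∈ Finset.range M, (ω ^ k * conj ω ^ l) ^ j = if k = l then (M : ℂ) else 0 := by
  have hu := mul_conj_of_norm_eq_one hω1
  split_ifs with h
  · simp [h, ← mul_pow, hu]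
  · have hne : ω ^ k * conj ω ^ l ≠ 1 := by
      intro e
      apply h
      refine hω.pow_inj hk hl ?_
      calc ω ^ k = ω ^ k * (ω * conj ω) ^ l := by rw [hu, one_pow, mul_one]
        _ = ω ^ k * conj ω ^ l * ω ^ l := by rw [mul_pow]; ring
        _ = ω ^ l := by rw [e, one_mul]
    have hM : (ω ^ k * conj ω ^ l) ^ M = 1 := by
      rw [mul_pow, ← pow_mul, ← pow_mul, mul_comm k, mul_comm l, pow_mul, pow_mul, ← map_pow,
        hω.pow_eq_one]
      simp
    have := mul_geom_sum (ω ^ k * conj ω ^ l) M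
    rw [hM, sub_self] at this
    exact (mul_eq_zero.mp this).resolve_left (sub_ne_zero.mpr hne)

/-- Parseval's identity on the points `z * ω ^ j`. -/
lemma sum_norm_sq_eval_eq {M : ℕ} {ω : ℂ} (hω : IsPrimitiveRoot ω M) (hω1 : ‖ω‖ = 1) {F : ℂ[X]}
    (hF : F.natDegree < M) {z : ℂ} (hz : ‖z‖ = 1) :
    ∑ j ∈ Finset.range M, ‖F.eval (z * ω ^ j)‖ ^ 2
      = M * ∑ k ∈ Finset.range M, ‖F.coeff k‖ ^ 2 := by
  have key : (∑ j ∈ Finset.range M, F.eval (z * ω ^ j) * conj (F.eval (z * ω ^ j)))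
      = M * ∑ k ∈ Finset.range M, F.coeff k * conj (F.coeff k) := by
    have e : ∀ j, F.eval (z * ω ^ j) * conj (F.eval (z * ω ^ j))
        = ∑ k ∈ Finset.range M, ∑ l ∈ Finset.range M,
          F.coeff k * conj (F.coeff l) * (z ^ k * conj z ^ l) * (ω ^ k * conj ω ^ l) ^ j := by
      intro j
      rw [eval_eq_sum_range' hF, map_sum, Finset.sum_mul_sum]
      refine Finset.sum_congr rfl fun k _ => Finset.sum_congr rfl fun l _ => ?_
      simp only [map_mul, map_pow, mul_pow, ← pow_mul, mul_comm k j, mul_comm l j]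
      ring
    simp_rw [e]
    rw [Finset.sum_comm, Finset.mul_sum]
    refine Finset.sum_congr rfl fun k hk => ?_
    rw [Finset.sum_comm, Finset.sum_eq_single k]
    · rw [← Finset.mul_sum, sum_pow_mul_conj_pow hω hω1 (Finset.mem_range.mp hk)
        (Finset.mem_range.mp hk), if_pos rfl, ← mul_pow, mul_conj_of_norm_eq_one hz, one_pow]
      ring
    · intro l hl hlk
      rw [← Finset.mul_sum, sum_pow_mul_conj_pow hω hω1 (Finset.mem_range.mp hk)
        (Finset.mem_range.mp hl), if_neg hlk.symm, mul_zero]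
    · exact fun h => absurd hk h
  simp only [Complex.mul_conj, Complex.normSq_eq_norm_sq] at key
  exact_mod_cast key

/-- The square of a geometric sum: the square of its modulus is the Jackson kernel. -/
lemma exists_kernel {m : ℕ} (hm : 0 < m) :
    ∃ F : ℂ[X], F.natDegree ≤ 2 * m ∧ ∃ E : ℝ, 0 < E ∧
      ∀ ω : ℂ, IsPrimitiveRoot ω (2 * m) → ‖ω‖ = 1 → ∀ z : ℂ, ‖z‖ = 1 →
        ∑ j ∈ Finset.range (2 * m), ‖F.eval (z * ω ^ j)‖ ^ 2 = E ∧
        ∑ j ∈ Finset.range (2 * m), ‖F.eval (z * ω ^ j)‖ ^ 2 * ‖1 - z * ω ^ j‖ ^ 2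
          ≤ 8 / (m : ℝ) ^ 2 * E := by
  have hm' : (0 : ℝ) < m := by exact_mod_cast hm
  set S : ℂ[X] := ∑ k ∈ Finset.range m, X ^ k with hS
  have hSd : S.natDegree ≤ m - 1 := by
    refine natDegree_sum_le_of_forall_le _ _ fun k hk => ?_
    rw [natDegree_X_pow]
    have := Finset.mem_range.mp hk
    omega
  -- The degree is below the number `2m` of nodes, so the sampled Parseval identity applies.
  have hFd : (S ^ 2).natDegree ≤ 2 * (m - 1) := natDegree_pow_le_of_le 2 hSd
  have hScoeff : ∑ k ∈ Finset.range (2 * m), ‖S.coeff k‖ ^ 2 = m := by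
    have e : ∀ k, ‖S.coeff k‖ ^ 2 = if k < m then 1 else 0 := by
      intro k
      rw [hS, finsetSum_coeff]
      simp only [coeff_X_pow, Finset.sum_ite_eq, Finset.mem_range]
      split_ifs <;> simp
    simp_rw [e]
    rw [← Finset.sum_filter, Finset.sum_const, nsmul_eq_mul, mul_one]
    congr 1
    rw [show (Finset.range (2 * m)).filter (· < m) = Finset.range m by
      ext k; simp only [Finset.mem_filter, Finset.mem_range]; omega, Finset.card_range]
  set E : ℝ := ∑ k ∈ Finset.range (2 * m), ‖(S ^ 2).coeff k‖ ^ 2 with hE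
  -- The value `m²` at `1` is the sum of at most `2m` coefficients; apply Cauchy–Schwarz.
  have hE1 : (m : ℝ) ^ 4 ≤ 2 * m * E := by
    have e1 : (S ^ 2).eval 1 = (m : ℂ) ^ 2 := by simp [hS, eval_finsetSum]
    rw [eval_eq_sum_range' (n := 2 * m) (by omega)] at e1
    have e2 : (m : ℝ) ^ 2 ≤ ∑ k ∈ Finset.range (2 * m), ‖(S ^ 2).coeff k‖ := by
      calc (m : ℝ) ^ 2 = ‖(m : ℂ) ^ 2‖ := by simp
        _ ≤ _ := by
          rw [← e1]
          refine (norm_sum_le _ _).trans (le_of_eq ?_)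
          simp
    calc (m : ℝ) ^ 4 = ((m : ℝ) ^ 2) ^ 2 := by ring
      _ ≤ (∑ k ∈ Finset.range (2 * m), ‖(S ^ 2).coeff k‖) ^ 2 := by gcongr
      _ ≤ _ := by
        refine sq_sum_le_card_mul_sum_sq.trans ?_
        rw [Finset.card_range]
        push_cast
        exact le_rfl
  have hE0 : 0 < E := by
    have h4 : 0 < 2 * m * E := lt_of_lt_of_le (by positivity) hE1
    exact (mul_pos_iff_of_pos_left (by positivity)).mp h4
  refine ⟨S ^ 2, hFd.trans (by omega), 2 * m * E, by positivity, fun ω hω hω1 z hz => ⟨?_, ?_⟩⟩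
  · rw [sum_norm_sq_eval_eq hω hω1 (by omega) hz]
    push_cast
    rfl
  · have hx : ∀ j, ‖(S ^ 2).eval (z * ω ^ j)‖ ^ 2 * ‖1 - z * ω ^ j‖ ^ 2
        ≤ 4 * ‖S.eval (z * ω ^ j)‖ ^ 2 := by
      intro j
      set x := z * ω ^ j with hxdef
      have hxn : ‖x‖ = 1 := by rw [hxdef, norm_mul, norm_pow, hz, hω1, one_pow, one_mul]
      have e : S.eval x * (1 - x) = 1 - x ^ m := by
        have := geom_sum_mul_neg x m
        rw [hS, eval_finsetSum]
        simpa using this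
      have e2 : ‖1 - x ^ m‖ ≤ 2 := by
        refine (norm_sub_le _ _).trans ?_
        rw [norm_pow, hxn, one_pow, norm_one]
        norm_num
      calc ‖(S ^ 2).eval x‖ ^ 2 * ‖1 - x‖ ^ 2
          = ‖S.eval x * (1 - x)‖ ^ 2 * ‖S.eval x‖ ^ 2 := by
            rw [eval_pow, norm_pow, norm_mul]
            ring
        _ ≤ 2 ^ 2 * ‖S.eval x‖ ^ 2 := by
            rw [e]
            gcongr
        _ = _ := by ring
    refine (Finset.sum_le_sum fun j _ => hx j).trans ?_
    rw [← Finset.mul_sum, sum_norm_sq_eval_eq hω hω1 (by omega) hz, hScoeff]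
    rw [div_mul_eq_mul_div, le_div_iff₀ (by positivity)]
    push_cast
    nlinarith

/-! ### Approximation of the fractional power -/

/-- For `|φ| ≤ π` both sides are comparable to `φ²`, and `π⁴/4 < 25`. Beyond `π` the left side is at
most `2`, while `1 - cos φ` is at least `δ²/5`, as `φ` stays `δ` away from `±2π`. -/
lemma one_sub_cos_mul_le {t δ φ : ℝ} (ht : t ∈ Set.Ioo (0 : ℝ) 1) (hδ : 0 < δ) (hδπ : δ ≤ Real.pi)
    (hφ : |φ| ≤ 2 * Real.pi - δ) :
    1 - Real.cos (t * φ) ≤ 25 / δ ^ 2 * (1 - Real.cos φ) := by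
  have hpi := Real.pi_pos
  have hpi2 : Real.pi ^ 2 < 9.93 := by
    have := Real.pi_lt_d2
    nlinarith
  have hδ2 : δ ^ 2 ≤ Real.pi ^ 2 := by gcongr
  rw [div_mul_eq_mul_div, le_div_iff₀ (by positivity)]
  rcases le_or_gt |φ| Real.pi with h | h
  · have h1 := Real.cos_le_one_sub_mul_cos_sq h
    have h2 := Real.one_sub_sq_div_two_le_cos (x := t * φ)
    have h3 : (t * φ) ^ 2 ≤ φ ^ 2 := by
      rw [mul_pow]
      exact mul_le_of_le_one_left (sq_nonneg φ) (pow_le_one₀ ht.1.le ht.2.le)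
    have h4 : 2 * φ ^ 2 ≤ Real.pi ^ 2 * (1 - Real.cos φ) := by
      have e : 2 * φ ^ 2 = Real.pi ^ 2 * (2 / Real.pi ^ 2 * φ ^ 2) := by field_simp
      rw [e]
      gcongr
      linarith
    have h5 : 0 ≤ 1 - Real.cos φ := sub_nonneg.mpr (Real.cos_le_one φ)
    calc (1 - Real.cos (t * φ)) * δ ^ 2 ≤ φ ^ 2 / 2 * Real.pi ^ 2 := by
          apply mul_le_mul _ hδ2 (sq_nonneg _) (by positivity)
          linarith
      _ ≤ Real.pi ^ 2 * (1 - Real.cos φ) / 4 * Real.pi ^ 2 := by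
          apply mul_le_mul_of_nonneg_right _ (sq_nonneg _)
          linarith
      _ = (Real.pi ^ 2 * Real.pi ^ 2 / 4) * (1 - Real.cos φ) := by ring
      _ ≤ 25 * (1 - Real.cos φ) := by
          apply mul_le_mul_of_nonneg_right _ h5
          nlinarith [sq_nonneg Real.pi]
  · have hy : |(2 * Real.pi - |φ|)| ≤ Real.pi := by
      rw [abs_of_nonneg (by linarith)]
      linarith
    have h1 := Real.cos_le_one_sub_mul_cos_sq hy
    rw [Real.cos_two_pi_sub, Real.cos_abs] at h1
    have h2 := Real.neg_one_le_cos (t * φ)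
    have h3 : δ ^ 2 ≤ (2 * Real.pi - |φ|) ^ 2 := by
      gcongr
      linarith
    have h4 : (2 / 10 : ℝ) ≤ 2 / Real.pi ^ 2 := by
      gcongr
      linarith
    have h5 : 2 / 10 * δ ^ 2 ≤ 2 / Real.pi ^ 2 * (2 * Real.pi - |φ|) ^ 2 := by gcongr
    nlinarith [sq_nonneg δ]

lemma norm_one_sub_exp_sq (x : ℝ) :
    ‖1 - Complex.exp (x * Complex.I)‖ ^ 2 = 2 * (1 - Real.cos x) := by
  rw [← Complex.normSq_eq_norm_sq, Complex.normSq_apply]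
  simp only [Complex.sub_re, Complex.one_re, Complex.exp_ofReal_mul_I_re, Complex.sub_im,
    Complex.one_im, Complex.exp_ofReal_mul_I_im]
  nlinarith [Real.sin_sq_add_cos_sq x]

/-- A polynomial of degree `4 m` smaller than one on the circle, which is close to
`z ^ (2 m) * z ^ t` away from the branch point. -/
theorem exists_approximation {m : ℕ} (hm : 0 < m) {t : ℝ} (ht : t ∈ Set.Ioo (0 : ℝ) 1) (α : ℝ) :
    ∃ P : ℂ[X], P.natDegree ≤ 4 * m ∧ (∀ z : ℂ, ‖z‖ = 1 → ‖P.eval z‖ < 1) ∧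
      ∀ δ θ : ℝ, 0 < δ → θ ∈ Set.Icc (α + δ) (α + 2 * Real.pi - δ) →
        1 - (conj (Complex.exp (θ * Complex.I)) ^ (2 * m) * P.eval (Complex.exp (θ * Complex.I))
          * conj (Complex.exp ((t * θ : ℝ) * Complex.I))).re ≤ 110 / (m ^ 2 * δ ^ 2) := by
  have hm1 : (1 : ℝ) ≤ m := by exact_mod_cast hm
  have hpi := Real.pi_pos
  obtain ⟨F, hF, E, hE, hker⟩ := exists_kernel hm
  set ω : ℂ := (Complex.exp (2 * Real.pi * Complex.I / (2 * m : ℕ)))⁻¹ with hω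
  have hωp : IsPrimitiveRoot ω (2 * m) := (Complex.isPrimitiveRoot_exp (2 * m) (by omega)).inv
  have hω1 : ‖ω‖ = 1 := hωp.norm'_eq_one (by omega)
  let ν : ℕ → ℝ := fun j => α + 2 * Real.pi * j / (2 * m : ℕ)
  let a : ℂ := Complex.exp ((-α : ℝ) * Complex.I)
  have ha : ‖a‖ = 1 := Complex.norm_exp_ofReal_mul_I _
  let f : ℕ → ℂ := fun j => Complex.exp ((t * ν j : ℝ) * Complex.I)
  have hf : ∀ j, ‖f j‖ = 1 := fun j => Complex.norm_exp_ofReal_mul_I _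
  let G : ℕ → ℂ[X] := fun j => F.comp (C (a * ω ^ j) * X)
  have hGd : ∀ j, (G j).natDegree ≤ 2 * m := fun j =>
    (natDegree_comp_le.trans (Nat.mul_le_mul hF ((natDegree_C_mul_le _ _).trans natDegree_X_le))).trans (by omega)
  have hGz : ∀ j z, (G j).eval z = F.eval (z * a * ω ^ j) := by
    intro j z
    simp only [G, eval_comp, eval_mul, eval_C, eval_X]
    congr 1
    ring
  -- Shrinking makes `P` strictly smaller than one, as Fejér–Riesz needs here, at a cost of the same
  -- order as the error.
  let s : ℝ := 1 - 1 / (m : ℝ) ^ 2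
  have hs0 : 0 ≤ s := sub_nonneg.mpr (div_le_one_of_le₀ (one_le_pow₀ hm1) (by positivity))
  have hs1 : s < 1 := sub_lt_self _ (by positivity)
  let P : ℂ[X] := C ((s / E : ℝ) : ℂ) *
    ∑ j ∈ Finset.range (2 * m), C (f j) * (G j * conjReflect (2 * m) (G j))
  have hPz : ∀ z : ℂ, ‖z‖ = 1 → P.eval z = z ^ (2 * m) * ((s / E : ℝ) *
      ∑ j ∈ Finset.range (2 * m), f j * (‖F.eval (z * a * ω ^ j)‖ ^ 2 : ℝ)) := by
    intro z hz
    simp only [P, eval_mul (p := C _), eval_C, eval_finsetSum,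
      eval_mul_conjReflect (hGd _) hz, hGz]
    rw [mul_left_comm, Finset.mul_sum (a := z ^ (2 * m))]
    congr 1
    exact Finset.sum_congr rfl fun j _ => mul_left_comm _ _ _
  refine ⟨P, ?_, fun z hz => ?_, fun δ θ hδ hθ => ?_⟩
  · refine (natDegree_C_mul_le _ _).trans (natDegree_sum_le_of_forall_le _ _ fun j _ =>
      (natDegree_C_mul_le _ _).trans (natDegree_mul_le.trans ?_))
    have := hGd j
    have := natDegree_conjReflect_le this
    omega
  · have hza : ‖z * a‖ = 1 := by rw [norm_mul, hz, ha, one_mul]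
    rw [hPz z hz, norm_mul, norm_pow, hz, one_pow, one_mul, norm_mul, Complex.norm_real,
      Real.norm_of_nonneg (by positivity)]
    calc s / E * ‖∑ j ∈ Finset.range (2 * m), f j * (‖F.eval (z * a * ω ^ j)‖ ^ 2 : ℝ)‖
        ≤ s / E * E := by
          gcongr
          refine (norm_sum_le _ _).trans (le_of_eq ?_)
          rw [← (hker ω hωp hω1 _ hza).1]
          refine Finset.sum_congr rfl fun j _ => ?_
          rw [norm_mul, hf, one_mul, Complex.norm_real, Real.norm_of_nonneg (by positivity)]
      _ = s := by field_simp
      _ < 1 := hs1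
  · set z := Complex.exp (θ * Complex.I) with hz
    have hz1 : ‖z‖ = 1 := Complex.norm_exp_ofReal_mul_I _
    have hza : ‖z * a‖ = 1 := by rw [norm_mul, hz1, ha, one_mul]
    obtain ⟨hk1, hk2⟩ := hker ω hωp hω1 _ hza
    set w : ℕ → ℝ := fun j => ‖F.eval (z * a * ω ^ j)‖ ^ 2 with hw
    have hδπ : δ ≤ Real.pi := by linarith [hθ.1, hθ.2]
    have hnode : ∀ j, z * a * ω ^ j = Complex.exp ((θ - ν j : ℝ) * Complex.I) := by
      intro j
      simp only [hz, a, hω, ν]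
      rw [inv_pow, ← Complex.exp_nat_mul, ← Complex.exp_neg, ← Complex.exp_add, ← Complex.exp_add]
      congr 1
      push_cast
      ring
    have hphase : ∀ j, (f j * conj (Complex.exp ((t * θ : ℝ) * Complex.I))).re
        = Real.cos (t * (θ - ν j)) := by
      intro j
      rw [← Complex.exp_conj, ← Complex.exp_add, map_mul, Complex.conj_I, Complex.conj_ofReal,
        ← Real.cos_neg, ← Complex.exp_ofReal_mul_I_re]
      congr 2
      push_cast
      ring
    have hre : (conj z ^ (2 * m) * P.eval z
        * conj (Complex.exp ((t * θ : ℝ) * Complex.I))).re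
        = s / E * ∑ j ∈ Finset.range (2 * m), w j * Real.cos (t * (θ - ν j)) := by
      have hzz : conj z ^ (2 * m) * z ^ (2 * m) = 1 := by
        rw [← mul_pow, mul_comm, mul_conj_of_norm_eq_one hz1, one_pow]
      rw [hPz z hz1, ← mul_assoc, hzz, one_mul, mul_assoc, Complex.re_ofReal_mul, Finset.sum_mul,
        Complex.re_sum]
      congr 1
      refine Finset.sum_congr rfl fun j _ => ?_
      rw [← hphase, mul_right_comm, mul_comm, Complex.re_ofReal_mul]
    have hsum : E - ∑ j ∈ Finset.range (2 * m), w j * Real.cos (t * (θ - ν j))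
        ≤ 100 / (m ^ 2 * δ ^ 2) * E := by
      calc E - ∑ j ∈ Finset.range (2 * m), w j * Real.cos (t * (θ - ν j))
          = ∑ j ∈ Finset.range (2 * m), w j * (1 - Real.cos (t * (θ - ν j))) := by
            rw [← hk1, ← Finset.sum_sub_distrib]
            exact Finset.sum_congr rfl fun j _ => by ring
        _ ≤ ∑ j ∈ Finset.range (2 * m),
              12.5 / δ ^ 2 * (w j * ‖1 - z * a * ω ^ j‖ ^ 2) := by
            refine Finset.sum_le_sum fun j hj => ?_
            rw [hnode, norm_one_sub_exp_sq]
            have hν0 : α ≤ ν j := le_add_of_nonneg_right (by positivity)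
            have hν1 : ν j ≤ α + 2 * Real.pi := by
              have hj' : (j : ℝ) ≤ (2 * m : ℕ) := by
                exact_mod_cast (Finset.mem_range.mp hj).le
              have : 2 * Real.pi * j / (2 * m : ℕ) ≤ 2 * Real.pi :=
                div_le_of_le_mul₀ (by positivity) (by positivity) (by gcongr)
              simp only [ν]
              linarith
            have hφ : |θ - ν j| ≤ 2 * Real.pi - δ := by
              rw [abs_le]
              constructor <;> linarith [hθ.1, hθ.2]
            have hw0 : 0 ≤ w j := sq_nonneg _
            calc w j * (1 - Real.cos (t * (θ - ν j)))
                ≤ w j * (25 / δ ^ 2 * (1 - Real.cos (θ - ν j))) := by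
                  gcongr
                  exact one_sub_cos_mul_le ht hδ hδπ hφ
              _ = _ := by ring
        _ ≤ 12.5 / δ ^ 2 * (8 / (m : ℝ) ^ 2 * E) := by
            rw [← Finset.mul_sum]
            gcongr
        _ = _ := by
            field_simp
            norm_num
    rw [hre]
    set T := ∑ j ∈ Finset.range (2 * m), w j * Real.cos (t * (θ - ν j)) with hT
    have hTE : T / E ≤ 1 := by
      refine div_le_one_of_le₀ ?_ hE.le
      rw [← hk1]
      exact Finset.sum_le_sum fun j _ =>
        mul_le_of_le_one_right (sq_nonneg _) (Real.cos_le_one _)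
    have hX : 1 - T / E ≤ 100 / (m ^ 2 * δ ^ 2) := by
      rw [← div_self hE.ne', ← sub_div]
      exact div_le_of_le_mul₀ hE.le (by positivity) hsum
    have hm2 : 1 / (m : ℝ) ^ 2 ≤ 10 / (m ^ 2 * δ ^ 2) := by
      rw [div_le_div_iff₀ (by positivity) (by positivity)]
      have h1 : δ ^ 2 ≤ 10 := by
        have := Real.pi_lt_d2
        nlinarith
      nlinarith [sq_nonneg (m : ℝ)]
    have e : s / E * T = T / E - 1 / (m : ℝ) ^ 2 * (T / E) := by
      simp only [s]
      ring
    have hmul : 1 / (m : ℝ) ^ 2 * (T / E) ≤ 1 / (m : ℝ) ^ 2 :=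
      mul_le_of_le_one_right (by positivity) hTE
    have hadd : (110 : ℝ) / (m ^ 2 * δ ^ 2) = 100 / (m ^ 2 * δ ^ 2) + 10 / (m ^ 2 * δ ^ 2) := by
      ring
    rw [e, hadd]
    linarith

/-! ### Assembling the circuit -/

lemma mem_Icc_of_hasPhaseGap {n : ℕ} {α δ : ℝ} (hδ : 0 < δ) (V : Matrix.unitaryGroup (Fin n) ℂ)
    {θ : Fin n → ℝ} (hθ : ∀ j, θ j ∈ Set.Ico α (α + 2 * Real.pi))
    (h : HasPhaseGap α δ (phaseOp V θ)) (j : Fin n) :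
    θ j ∈ Set.Icc (α + δ) (α + 2 * Real.pi - δ) := by
  have hmem : Complex.exp (θ j * Complex.I) ∈ spectrum ℂ (phaseOp V θ) := by
    have e := Unitary.spectrum_star_right_conjugate (R := ℂ)
      (a := Matrix.diagonal fun j => Complex.exp ((θ j : ℂ) * Complex.I)) (U := V)
    have e' : spectrum ℂ (phaseOp V θ) = _ := e
    rw [e', spectrum_diagonal]
    exact ⟨j, rfl⟩
  obtain ⟨φ, hφ, he⟩ := h _ hmem
  obtain ⟨k, hk⟩ := Complex.exp_eq_exp_iff_exists_int.mp he
  have e : θ j = φ + k * (2 * Real.pi) := by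
    have : (θ j : ℂ) = ((φ + k * (2 * Real.pi) : ℝ) : ℂ) := by
      apply mul_right_cancel₀ Complex.I_ne_zero
      rw [hk]
      push_cast
      ring
    exact_mod_cast this
  have hpi := Real.pi_pos
  obtain ⟨h0, h1⟩ := hθ j
  have hk1 : (k : ℝ) < 1 := by nlinarith [hφ.1]
  have hk0 : (-1 : ℝ) < k := by nlinarith [hφ.2]
  have : k < 1 := by exact_mod_cast hk1
  have : -1 < k := by exact_mod_cast hk0
  obtain rfl : k = 0 := by omega
  rw [e]
  simpa using hφ

/-- For a unit vector the overlap determines the whole error, so the ancilla component `B` needs no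
separate estimate. -/
lemma norm_sub_sq_add_eq {A B f : ℂ} (h : ‖A‖ ^ 2 + ‖B‖ ^ 2 = 1) (hf : ‖f‖ = 1) :
    ‖A - f‖ ^ 2 + ‖B‖ ^ 2 = 2 * (1 - (A * conj f).re) := by
  have e : ‖A - f‖ ^ 2 = ‖A‖ ^ 2 + ‖f‖ ^ 2 - 2 * (A * conj f).re := by
    simp only [← Complex.normSq_eq_norm_sq]
    exact Complex.normSq_sub A f
  rw [e, hf]
  linarith

/-- A circuit for `U ^ t` of running time `O(C_U / ε)` and precision `ε / δ`. -/
theorem exists_circuit_implements {t : ℝ} (ht : t ∈ Set.Ioo (0 : ℝ) 1) (α : ℝ) {ε : ℝ}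
    (hε : ε ∈ Set.Ioc (0 : ℝ) 1) :
    ∃ c : Circuit 1, (∀ CU : ℝ, 1 ≤ CU → c.time CU ≤ 272 * CU / ε) ∧
      ∀ (n : ℕ) (U P : Matrix (Fin n) (Fin n) ℂ) (δ : ℝ), 0 < δ →
        IsFracPower α t U P → HasPhaseGap α δ U →
        Implements (c.eval U) (zeroKet 1) (zeroKet 1) P (ε / δ) := by
  obtain ⟨hε0, hε1⟩ := hε
  -- The squared error is at most `2 * 110 / (m² δ²)`, and `15² = 225` exceeds `220`.
  set m := ⌈15 / ε⌉₊ with hm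
  have hm0 : 0 < m := Nat.ceil_pos.mpr (by positivity)
  have hmlow : 15 / ε ≤ m := Nat.le_ceil _
  have hmup : (m : ℝ) * ε ≤ 16 := by
    have h1 : (m : ℝ) < 15 / ε + 1 := Nat.ceil_lt_add_one (by positivity)
    have h2 : (15 / ε + 1) * ε = 15 + ε := by field_simp
    nlinarith
  obtain ⟨P, hPd, hP1, happ⟩ := exists_approximation hm0 ht α
  obtain ⟨Q, hQd, hPQ⟩ := exists_complementary hPd hP1
  obtain ⟨c, hct, hcz⟩ := exists_circuit_run_eq (4 * m) P Q hPd hQd hPQ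
  obtain ⟨c', hct', hcz'⟩ := exists_circuit_run_shift (2 * m)
  refine ⟨c ++ c', fun CU hCU => ?_, ?_⟩
  · rw [Circuit.time_append, hct, hct', le_div_iff₀ hε0]
    push_cast
    have h1 : (1 : ℝ) ≤ m := by exact_mod_cast hm0
    -- The total `8m(CU + 1) + 1` is at most `17 m CU` because `CU` and `m` are at least one; `17 *
    -- 16 = 272`.
    calc (4 * m * (CU + 1) + 1 + 2 * m * (2 * CU + 2)) * ε ≤ 17 * m * CU * ε := by
          gcongr
          nlinarith
      _ = 17 * CU * (m * ε) := by ring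
      _ ≤ 17 * CU * 16 := by gcongr
      _ = 272 * CU := by ring
  · rintro n U R δ hδ ⟨V, θ, hθ, rfl, rfl⟩ hgap
    refine implements_of_run V θ (fun j => t * θ j) (c ++ c') (by positivity) fun j => ?_
    have hz : ‖Complex.exp (θ j * Complex.I)‖ = 1 := Complex.norm_exp_ofReal_mul_I _
    have hb := happ δ (θ j) hδ (mem_Icc_of_hasPhaseGap hδ V hθ hgap j)
    rw [Circuit.run_append, hcz _ hz, hcz']
    set z := Complex.exp (θ j * Complex.I)
    simp only [Pi.smul_apply, smul_eq_mul, Matrix.cons_val_zero, Matrix.cons_val_one]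
    have hcz1 : ‖conj z ^ (2 * m)‖ = 1 := by rw [norm_pow, RCLike.norm_conj, hz, one_pow]
    rw [norm_sub_sq_add_eq _ (Complex.norm_exp_ofReal_mul_I _)]
    · have h15 : 15 ≤ m * ε := (div_le_iff₀ hε0).mp hmlow
      refine (mul_le_mul_of_nonneg_left hb zero_le_two).trans ?_
      rw [div_pow, mul_div_assoc', div_le_div_iff₀ (by positivity) (by positivity)]
      have : 2 * 110 ≤ (m * ε) ^ 2 := by nlinarith
      nlinarith [sq_nonneg δ]
    · rw [norm_mul, norm_mul, hcz1, one_mul, one_mul]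
      exact hPQ z hz

end QuantumPower

theorem mainTheorem4 :
    -- `U ^ t` is implemented in time `O(C_U / ε)` to precision `ε / δ`
    (∃ C : ℝ, 0 < C ∧ ∀ t ∈ Set.Ioo (0 : ℝ) 1, ∀ α : ℝ, ∀ ε ∈ Set.Ioc (0 : ℝ) 1,
      ∃ (a : ℕ) (c : QuantumPower.Circuit a),
        (∀ CU : ℝ, 1 ≤ CU → c.time CU ≤ C * CU / ε) ∧
        ∀ (n : ℕ) (U P : Matrix (Fin n) (Fin n) ℂ) (δ : ℝ), 0 < δ →
          QuantumPower.IsFracPower α t U P → QuantumPower.HasPhaseGap α δ U →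
          QuantumPower.Implements (c.eval U) (QuantumPower.zeroKet a) (QuantumPower.zeroKet a)
            P (ε / δ)) ∧
    -- and every algorithm with this guarantee uses `U` at least `Ω(1 / ε)` times
    (∀ t ∈ Set.Ioo (0 : ℝ) 1, ∃ κ : ℝ, 0 < κ ∧ ∃ ε₀ : ℝ, 0 < ε₀ ∧
      ∀ α : ℝ, ∀ ε ∈ Set.Ioc (0 : ℝ) ε₀, ∀ n : ℕ, 2 ≤ n →
      ∀ (A : Type) [Fintype A] [DecidableEq A] (alg : QuantumPower.QueryAlgorithm n A),
        (∀ (U P : Matrix (Fin n) (Fin n) ℂ) (δ : ℝ), 0 < δ →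
          QuantumPower.IsFracPower α t U P → QuantumPower.HasPhaseGap α δ U →
          ∃ g : EuclideanSpace ℂ A, ‖g‖ = 1 ∧
            QuantumPower.Implements (alg.eval U) alg.init g P (ε / δ)) →
        κ / ε ≤ (alg.queries : ℝ)) ∧
    -- already precision `η = η(t)` on all `U` with phase gap `ε` requires `Ω(1 / ε)` uses of `U`
    (∀ t ∈ Set.Ioo (0 : ℝ) 1, ∃ κ : ℝ, 0 < κ ∧ ∃ η : ℝ, 0 < η ∧ ∃ ε₀ : ℝ, 0 < ε₀ ∧
      ∀ α : ℝ, ∀ ε ∈ Set.Ioc (0 : ℝ) ε₀, ∀ n : ℕ, 2 ≤ n →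
      ∀ (A : Type) [Fintype A] [DecidableEq A] (alg : QuantumPower.QueryAlgorithm n A),
        (∀ U P : Matrix (Fin n) (Fin n) ℂ,
          QuantumPower.IsFracPower α t U P → QuantumPower.HasPhaseGap α ε U →
          ∃ g : EuclideanSpace ℂ A, ‖g‖ = 1 ∧
            QuantumPower.Implements (alg.eval U) alg.init g P η) →
        κ / ε ≤ (alg.queries : ℝ)) := by
  have scale : ∀ t ∈ Set.Ioo (0 : ℝ) 1, ∃ s : ℝ, 0 < s ∧
      s = ‖Complex.exp (((t * (2 * Real.pi) : ℝ) : ℂ) * Complex.I) - 1‖ := fun t ht =>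
    ⟨_, QuantumPower.norm_exp_mul_two_pi_sub_one_pos ht, rfl⟩
  refine ⟨⟨272, by norm_num, fun t ht α ε hε => ⟨1, ?_⟩⟩, fun t ht => ?_, fun t ht => ?_⟩
  · exact QuantumPower.exists_circuit_implements ht α hε
  · obtain ⟨s, hs, hst⟩ := scale t ht
    refine ⟨s / 8 * (s / 16), by positivity, s / 8 * (s / 16), by positivity, ?_⟩
    intro α ε hε n hn A _ _ alg h
    have hε0 := hε.1
    -- With gap `δ = ε / (s / 16)` the required precision `ε / δ` is the constant `s / 16`.
    have hε' : ε / (s / 16) ∈ Set.Ioc 0 (s / 8) :=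
      ⟨by positivity, (div_le_iff₀ (by positivity)).mpr hε.2⟩
    have := QuantumPower.queries_lower_bound ht hst hε' hn alg fun U P hP hU => by
      have := h U P _ hε'.1 hP hU
      rwa [div_div_cancel₀ hε0.ne'] at this
    rwa [div_div_eq_mul_div] at this
  · obtain ⟨s, hs, hst⟩ := scale t ht
    refine ⟨s / 8, by positivity, s / 16, by positivity, s / 8, by positivity, ?_⟩
    intro α ε hε n hn A _ _ alg h
    exact QuantumPower.queries_lower_bound ht hst hε hn alg h
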